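/- Conventions. The finite types are $0$ and, with $\sigma,\tau$, also $\sigma\to\tau$; $1=0\to0$ and $n+1=n\to0$. Rational numbers are coded by natural numbers, and real numbers by type $1$ objects $x$, i.e. by sequences $([x](n))_n$ of rationals with $|[x](n)-[x](n+1)|<2^{-(n+1)}$; a sequence that violates this condition is read as constant from its first failure on (Kohlenbach's hat function), so that every type $1$ object codes a real. We write $x=_{\mathbb R}y$ for $(\forall n)(|[x](n)-[y](n)|\le 2^{-n+1})$ and $x<_{\mathbb R}y$ for $(\exists n)([x](n)+2^{-n+1}<[y](n))$. A function $Y:\mathbb R\to\mathbb R$ is an object of type $1\to1$ that respects $=_{\mathbb R}$; it represents the set of all $x$ with $Y(x)>_{\mathbb R}0$ (written $x\in Y$), and is called an open set if for every $x\in Y$ there is a rational $r>0$ with $B(x,r)\subseteq Y$. $\mathrm{RCA}_0^\omega$ is the theory in classical many-sorted logic over all finite types, with prime formulas $s=_0t$ and $s<_0t$ and with equality at higher types defined extensionally, which consists of: the axioms of a (discretely) ordered semi-ring with equality for $0,1,+,\times,<,=_0$; the defining axioms of the combinators $\Pi,\Sigma$ and of the recursor $\mathbf R_0$; the axiom of extensionality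 $x=_\rho y\to\varphi(x)=_\tau\varphi(y)$ for all types; induction for quantifier-free formulas; and the quantifier-free axiom of choice $\mathrm{QF\text{-}AC}^{1,0}$. The axiom $(\exists^3)$ is $$(\exists E^3\le_31)(\forall Y^2)\big[(\exists f^1)(Y(f)=0)\leftrightarrow E(Y)=0\big],$$ and $\mathrm{Z}_2^\Omega$ is $\mathrm{RCA}_0^\omega+(\exists^3)$. Let $(B(q_n,r_n))_{n\in\mathbb N}$ be a fixed enumeration of all open balls in $\mathbb R$ with rational centre and positive rational radius. The principle $\mathsf{open}$ states: for every open set $Y\subseteq\mathbb R$ there is $X\subseteq\mathbb N$ such that $(\forall n\in\mathbb N)\big(n\in X\leftrightarrow B(q_n,r_n)\subseteq Y\big)$. Theorem 4.17. 1. The system $\mathrm{Z}_2^\Omega$ proves $\mathsf{open}$. 2. There is a closed term $t$ of Gödel's system $T$ (built from $0,1,+,\times$, the combinators $\Pi,\Sigma$ and the recursors $\mathbf R_\sigma$ of all finite types) such that, in the full type structure over $\mathbb N$, $\Psi:=t(\exists^3)$ is a $\Psi$-functional: for every $Y:\mathbb R\to\mathbb R$ representing an open set, $\Psi(Y)$ consists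 of two sequences of rationals $(a_n)_{n\in\mathbb N}$ and $(r_n)_{n\in\mathbb N}$, with $r_n\ge0$, such that $Y=\bigcup_{n\in\mathbb N}B(a_n,r_n)$. Here $\exists^3$ is the type $3$ functional with $\exists^3(Y)=0$ if $Y(f)=0$ for some $f\in\mathbb N^{\mathbb N}$, and $\exists^3(Y)=1$ otherwise. -/

import Mathlib

namespace FinTypes

/-! ### Finite types, terms and formulas of higher-order arithmetic -/

/-- The finite types: `nat` is the type `0`, and `σ ⇒ τ` is the type of maps from `σ` to `τ`. -/
inductive Ty : Type
  | nat : Ty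
  | arr : Ty → Ty → Ty

infixr:60 " ⇒ " => Ty.arr

/-- The pure types `0`, `1 = 0 → 0`, `2 = 1 → 0`, `3 = 2 → 0`, and so on. -/
@[reducible] def Ty.pure : ℕ → Ty
  | 0 => Ty.nat
  | n + 1 => Ty.pure n ⇒ Ty.nat

/-- Typed de Bruijn variables: the variables of type `σ` available in a context. -/
inductive Var : List Ty → Ty → Type
  | zero {Γ : List Ty} {σ : Ty} : Var (σ :: Γ) σ
  | succ {Γ : List Ty} {σ τ : Ty} : Var Γ σ → Var (τ :: Γ) σ

/-- Terms: variables, application, `0`, `1`, `+`, `×`, the combinators `Π` (here `K`) and `Σ`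
(here `S`), and a recursor `R σ` for every type `σ`.  The closed terms are the terms of Gödel's
system `T`. -/
inductive Tm (Γ : List Ty) : Ty → Type
  | var {σ : Ty} : Var Γ σ → Tm Γ σ
  | app {σ τ : Ty} : Tm Γ (σ ⇒ τ) → Tm Γ σ → Tm Γ τ
  | zero : Tm Γ Ty.nat
  | one : Tm Γ Ty.nat
  | add : Tm Γ (Ty.nat ⇒ Ty.nat ⇒ Ty.nat)
  | mul : Tm Γ (Ty.nat ⇒ Ty.nat ⇒ Ty.nat)
  | K (σ τ : Ty) : Tm Γ (σ ⇒ τ ⇒ σ)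
  | S (ρ σ τ : Ty) : Tm Γ ((ρ ⇒ σ ⇒ τ) ⇒ (ρ ⇒ σ) ⇒ ρ ⇒ τ)
  | R (σ : Ty) : Tm Γ ((Ty.nat ⇒ σ ⇒ σ) ⇒ σ ⇒ Ty.nat ⇒ σ)

infixl:90 " ⬝ " => Tm.app

/-- Simultaneous substitutions of terms over `Δ` for the variables of `Γ`. -/
abbrev Sub (Γ Δ : List Ty) : Type := ∀ τ : Ty, Var Γ τ → Tm Δ τ

namespace Tm

def subst {Γ Δ : List Ty} (θ : Sub Γ Δ) : {σ : Ty} → Tm Γ σ → Tm Δ σ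
  | _, var v => θ _ v
  | _, app s t => app (subst θ s) (subst θ t)
  | _, zero => zero
  | _, one => one
  | _, add => add
  | _, mul => mul
  | _, K σ τ => K σ τ
  | _, S ρ σ τ => S ρ σ τ
  | _, R σ => R σ

/-- Weakening by one fresh variable. -/
def wk {Γ : List Ty} {τ σ : Ty} (t : Tm Γ σ) : Tm (τ :: Γ) σ :=
  t.subst fun _ v => var v.succ

/-- The usual definition of `λ`-abstraction (over the most recent variable) from `K` and `S`. -/
def lam {Γ : List Ty} {ρ : Ty} : {σ : Ty} → Tm (ρ :: Γ) σ → Tm Γ (ρ ⇒ σ)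
  | _, var Var.zero => S ρ (ρ ⇒ ρ) ρ ⬝ K ρ (ρ ⇒ ρ) ⬝ K ρ ρ
  | _, var (Var.succ v) => K _ ρ ⬝ var v
  | _, app s t => S ρ _ _ ⬝ lam s ⬝ lam t
  | _, zero => K _ ρ ⬝ zero
  | _, one => K _ ρ ⬝ one
  | _, add => K _ ρ ⬝ add
  | _, mul => K _ ρ ⬝ mul
  | _, K σ τ => K _ ρ ⬝ K σ τ
  | _, S ρ' σ τ => K _ ρ ⬝ S ρ' σ τ
  | _, R σ => K _ ρ ⬝ R σ

end Tm

namespace Sub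

/-- Extend a substitution by a term for the most recent variable. -/
def cons {Γ Δ : List Ty} {σ : Ty} (t : Tm Δ σ) (θ : Sub Γ Δ) : Sub (σ :: Γ) Δ
  | _, Var.zero => t
  | _, Var.succ v => θ _ v

/-- Carry a substitution under a quantifier. -/
def lift {Γ Δ : List Ty} {σ : Ty} (θ : Sub Γ Δ) : Sub (σ :: Γ) (σ :: Δ) :=
  cons (Tm.var Var.zero) fun τ v => (θ τ v).wk

/-- The identity substitution. -/
def id (Γ : List Ty) : Sub Γ Γ := fun _ v => Tm.var v

/-- The weakening substitution. -/
def shift (Γ : List Ty) (σ : Ty) : Sub Γ (σ :: Γ) := fun _ v => Tm.var v.succ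

end Sub

/-- Formulas of classical many-sorted logic with prime formulas `s =₀ t` and `s <₀ t`; the other
connectives are defined from `⊥`, `→`, `∀`. -/
inductive Fm : List Ty → Type
  | eq {Γ : List Ty} : Tm Γ Ty.nat → Tm Γ Ty.nat → Fm Γ
  | lt {Γ : List Ty} : Tm Γ Ty.nat → Tm Γ Ty.nat → Fm Γ
  | bot {Γ : List Ty} : Fm Γ
  | imp {Γ : List Ty} : Fm Γ → Fm Γ → Fm Γ
  | all {Γ : List Ty} (σ : Ty) : Fm (σ :: Γ) → Fm Γ

namespace Fm

variable {Γ : List Ty}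

def neg (φ : Fm Γ) : Fm Γ := imp φ bot
def and (φ ψ : Fm Γ) : Fm Γ := neg (imp φ (neg ψ))
def or (φ ψ : Fm Γ) : Fm Γ := imp (neg φ) ψ
def iff (φ ψ : Fm Γ) : Fm Γ := and (imp φ ψ) (imp ψ φ)
def ex (σ : Ty) (φ : Fm (σ :: Γ)) : Fm Γ := neg (all σ (neg φ))

/-- `s ≤₀ t`. -/
def le (s t : Tm Γ Ty.nat) : Fm Γ := or (lt s t) (eq s t)

def subst : {Γ Δ : List Ty} → Sub Γ Δ → Fm Γ → Fm Δ
  | _, _, θ, eq s t => eq (s.subst θ) (t.subst θ)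
  | _, _, θ, lt s t => lt (s.subst θ) (t.subst θ)
  | _, _, _, bot => bot
  | _, _, θ, imp φ ψ => imp (subst θ φ) (subst θ ψ)
  | _, _, θ, all σ φ => all σ (subst θ.lift φ)

/-- Weakening by one fresh variable. -/
def wk {σ : Ty} (φ : Fm Γ) : Fm (σ :: Γ) := φ.subst (Sub.shift Γ σ)

/-- Instantiation of the most recent variable. -/
def inst {σ : Ty} (φ : Fm (σ :: Γ)) (t : Tm Γ σ) : Fm Γ := φ.subst (Sub.cons t (Sub.id Γ))

/-- Quantifier-free formulas (variables of all types are allowed). -/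
def QF : {Γ : List Ty} → Fm Γ → Prop
  | _, eq _ _ => True
  | _, lt _ _ => True
  | _, bot => True
  | _, imp φ ψ => QF φ ∧ QF ψ
  | _, all _ _ => False

/-- Equality at an arbitrary type, defined from `=₀` by quantifying over all arguments. -/
def eqAt : {Γ : List Ty} → (σ : Ty) → Tm Γ σ → Tm Γ σ → Fm Γ
  | _, Ty.nat, s, t => eq s t
  | _, σ ⇒ τ, s, t => all σ (eqAt τ (s.wk ⬝ Tm.var Var.zero) (t.wk ⬝ Tm.var Var.zero))

end Fm

/-! ### Derivability -/

/-- Natural deduction for classical many-sorted first-order logic.  `Proves Ax Δ φ` says that `φ`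
is derivable from the hypotheses `Δ` and the axioms `Ax`; an axiom may have free variables, and
then stands for its universal closure. -/
inductive Proves (Ax : ∀ Γ : List Ty, Fm Γ → Prop) : {Γ : List Ty} → List (Fm Γ) → Fm Γ → Prop
  | ax {Γ : List Ty} {Δ : List (Fm Γ)} {φ : Fm Γ} : Ax Γ φ → Proves Ax Δ φ
  | hyp {Γ : List Ty} {Δ : List (Fm Γ)} {φ : Fm Γ} : φ ∈ Δ → Proves Ax Δ φ
  | impI {Γ : List Ty} {Δ : List (Fm Γ)} {φ ψ : Fm Γ} :
      Proves Ax (φ :: Δ) ψ → Proves Ax Δ (Fm.imp φ ψ)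
  | impE {Γ : List Ty} {Δ : List (Fm Γ)} {φ ψ : Fm Γ} :
      Proves Ax Δ (Fm.imp φ ψ) → Proves Ax Δ φ → Proves Ax Δ ψ
  | raa {Γ : List Ty} {Δ : List (Fm Γ)} {φ : Fm Γ} :
      Proves Ax (Fm.neg φ :: Δ) Fm.bot → Proves Ax Δ φ
  | allI {Γ : List Ty} {Δ : List (Fm Γ)} {σ : Ty} {φ : Fm (σ :: Γ)} :
      Proves Ax (Δ.map Fm.wk) φ → Proves Ax Δ (Fm.all σ φ)
  | allE {Γ : List Ty} {Δ : List (Fm Γ)} {σ : Ty} {φ : Fm (σ :: Γ)} :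
      Proves Ax Δ (Fm.all σ φ) → (t : Tm Γ σ) → Proves Ax Δ (φ.inst t)

/-! ### Arithmetical terms -/

namespace Tm

variable {Γ : List Ty}

/-- The most recent variable, and the one before it. -/
def v0 {σ : Ty} : Tm (σ :: Γ) σ := var Var.zero
def v1 {σ τ : Ty} : Tm (τ :: σ :: Γ) σ := var Var.zero.succ

def plus (s t : Tm Γ Ty.nat) : Tm Γ Ty.nat := add ⬝ s ⬝ t
def times (s t : Tm Γ Ty.nat) : Tm Γ Ty.nat := mul ⬝ s ⬝ t
def suc (s : Tm Γ Ty.nat) : Tm Γ Ty.nat := plus s one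

/-- Primitive recursion `h 0 = a`, `h (i + 1) = b`, evaluated at `n`; in `b`, the variable `v0` is
the previous value `h i` and `v1` is `i`. -/
def primrec (a : Tm Γ Ty.nat) (b : Tm (Ty.nat :: Ty.nat :: Γ) Ty.nat) (n : Tm Γ Ty.nat) :
    Tm Γ Ty.nat :=
  R Ty.nat ⬝ lam (lam b) ⬝ a ⬝ n

def pred (n : Tm Γ Ty.nat) : Tm Γ Ty.nat := primrec zero v1 n

/-- Truncated subtraction. -/
def monus (s t : Tm Γ Ty.nat) : Tm Γ Ty.nat := primrec s (pred v0) t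

/-- `a` if `c = 0`, and `b` otherwise. -/
def ifz (c a b : Tm Γ Ty.nat) : Tm Γ Ty.nat := primrec a b.wk.wk c

/-- `ltz s t` equals `0` if and only if `s < t`. -/
def ltz (s t : Tm Γ Ty.nat) : Tm Γ Ty.nat := monus (suc s) t

/-- `2 ^ n`. -/
def pow2 (n : Tm Γ Ty.nat) : Tm Γ Ty.nat := primrec one (plus v0 v0) n

/-- The integer part of the square root. -/
def isqrt (n : Tm Γ Ty.nat) : Tm Γ Ty.nat :=
  primrec zero (ifz (ltz (suc v1) (times (suc v0) (suc v0))) v0 (suc v0)) n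

/-- The bijective pairing `(a, b) ↦ b² + a` if `a < b`, and `a² + a + b` otherwise. -/
def pair (a b : Tm Γ Ty.nat) : Tm Γ Ty.nat :=
  ifz (ltz a b) (plus (times b b) a) (plus (plus (times a a) a) b)

/-- `n` minus the square of the integer part of its square root. -/
def excess (n : Tm Γ Ty.nat) : Tm Γ Ty.nat := monus n (times (isqrt n) (isqrt n))

/-- The inverse of the pairing, first component. -/
def fst (n : Tm Γ Ty.nat) : Tm Γ Ty.nat := ifz (ltz (excess n) (isqrt n)) (excess n) (isqrt n)

/-- The inverse of the pairing, second component. -/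
def snd (n : Tm Γ Ty.nat) : Tm Γ Ty.nat :=
  ifz (ltz (excess n) (isqrt n)) (isqrt n) (monus (excess n) (isqrt n))

/-! Rational numbers: the number `⟨⟨p, m⟩, d⟩` codes `(p - m) / (d + 1)`. -/

/-- The code of `(p - m) / d`, for `d > 0`. -/
def qmk (p m d : Tm Γ Ty.nat) : Tm Γ Ty.nat := pair (pair p m) (pred d)

def qpos (q : Tm Γ Ty.nat) : Tm Γ Ty.nat := fst (fst q)
def qneg (q : Tm Γ Ty.nat) : Tm Γ Ty.nat := snd (fst q)
def qden (q : Tm Γ Ty.nat) : Tm Γ Ty.nat := suc (snd q)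

/-- The rational number `0`. -/
def qzero : Tm Γ Ty.nat := qmk zero zero one

/-- The rational number `2 ^ (-n)`. -/
def qhalfpow (n : Tm Γ Ty.nat) : Tm Γ Ty.nat := qmk one zero (pow2 n)

/-- Addition of rational numbers. -/
def qadd (q r : Tm Γ Ty.nat) : Tm Γ Ty.nat :=
  qmk (plus (times (qpos q) (qden r)) (times (qpos r) (qden q)))
    (plus (times (qneg q) (qden r)) (times (qneg r) (qden q)))
    (times (qden q) (qden r))

/-- Subtraction of rational numbers. -/
def qsub (q r : Tm Γ Ty.nat) : Tm Γ Ty.nat := qadd q (qmk (qneg r) (qpos r) (qden r))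

/-- `q <_ℚ r` holds if and only if `qltL q r < qltR q r`. -/
def qltL (q r : Tm Γ Ty.nat) : Tm Γ Ty.nat :=
  plus (times (qpos q) (qden r)) (times (qneg r) (qden q))
def qltR (q r : Tm Γ Ty.nat) : Tm Γ Ty.nat :=
  plus (times (qpos r) (qden q)) (times (qneg q) (qden r))

/-- `qltz q r` equals `0` if and only if `q <_ℚ r`. -/
def qltz (q r : Tm Γ Ty.nat) : Tm Γ Ty.nat := ltz (qltL q r) (qltR q r)

/-! Real numbers are coded by sequences of (codes of) rational numbers. -/

/-- The least `k < n` such that `|f k - f (k + 1)| ≥ 2 ^ (-(k + 1))`, and `n` if there is none. -/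
def hatIdx (f : Tm Γ (Ty.pure 1)) (n : Tm Γ Ty.nat) : Tm Γ Ty.nat :=
  primrec zero
    (ifz (plus (monus v1 v0)
        (plus (qltz (qsub (f.wk.wk ⬝ v1) (f.wk.wk ⬝ suc v1)) (qhalfpow (suc v1)))
          (qltz (qsub (f.wk.wk ⬝ suc v1) (f.wk.wk ⬝ v1)) (qhalfpow (suc v1)))))
      (suc v0) v0) n

/-- The `n`-th approximation `[x](n)` of the real number coded by `x`: the `hat` of `x` follows
`x` as long as `x` converges fast, and is constant from the first failure on.  In this way every
object of type `1` codes a real number. -/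
def hat (x : Tm Γ (Ty.pure 1)) (n : Tm Γ Ty.nat) : Tm Γ Ty.nat := x ⬝ hatIdx x n

/-- The rational number `q` as a real number. -/
def ratReal (q : Tm Γ Ty.nat) : Tm Γ (Ty.pure 1) := K Ty.nat Ty.nat ⬝ q

/-- The sum of the real number `x` and the rational number `q`. -/
def addRat (x : Tm Γ (Ty.pure 1)) (q : Tm Γ Ty.nat) : Tm Γ (Ty.pure 1) :=
  lam (qadd (hat x.wk v0) q.wk)

/-- The fixed enumeration of all balls with rational centre and positive rational radius: the
centre of the `n`-th ball. -/
def ballCentre (n : Tm Γ Ty.nat) : Tm Γ Ty.nat := fst n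

/-- The radius of the `n`-th ball. -/
def ballRadius (n : Tm Γ Ty.nat) : Tm Γ Ty.nat :=
  qmk (suc (fst (snd n))) zero (suc (snd (snd n)))

end Tm

/-! ### The axiom systems -/

open Tm in
/-- The axioms of the base theory `RCA₀^ω`. -/
inductive RCA0omega : ∀ Γ : List Ty, Fm Γ → Prop
  -- `0, 1, <, +, ×` form a (discretely) ordered semi-ring with equality `=₀`
  | eq_refl {Γ : List Ty} (a : Tm Γ Ty.nat) : RCA0omega Γ (Fm.eq a a)
  | eq_symm {Γ : List Ty} (a b : Tm Γ Ty.nat) :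
      RCA0omega Γ (Fm.imp (Fm.eq a b) (Fm.eq b a))
  | eq_trans {Γ : List Ty} (a b c : Tm Γ Ty.nat) :
      RCA0omega Γ (Fm.imp (Fm.eq a b) (Fm.imp (Fm.eq b c) (Fm.eq a c)))
  | lt_congr {Γ : List Ty} (a a' b b' : Tm Γ Ty.nat) :
      RCA0omega Γ (Fm.imp (Fm.eq a a') (Fm.imp (Fm.eq b b') (Fm.imp (Fm.lt a b) (Fm.lt a' b'))))
  | add_zero {Γ : List Ty} (a : Tm Γ Ty.nat) : RCA0omega Γ (Fm.eq (plus a zero) a)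
  | add_comm {Γ : List Ty} (a b : Tm Γ Ty.nat) : RCA0omega Γ (Fm.eq (plus a b) (plus b a))
  | add_assoc {Γ : List Ty} (a b c : Tm Γ Ty.nat) :
      RCA0omega Γ (Fm.eq (plus (plus a b) c) (plus a (plus b c)))
  | mul_zero {Γ : List Ty} (a : Tm Γ Ty.nat) : RCA0omega Γ (Fm.eq (times a zero) zero)
  | mul_one {Γ : List Ty} (a : Tm Γ Ty.nat) : RCA0omega Γ (Fm.eq (times a one) a)
  | mul_comm {Γ : List Ty} (a b : Tm Γ Ty.nat) : RCA0omega Γ (Fm.eq (times a b) (times b a))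
  | mul_assoc {Γ : List Ty} (a b c : Tm Γ Ty.nat) :
      RCA0omega Γ (Fm.eq (times (times a b) c) (times a (times b c)))
  | mul_add {Γ : List Ty} (a b c : Tm Γ Ty.nat) :
      RCA0omega Γ (Fm.eq (times a (plus b c)) (plus (times a b) (times a c)))
  | lt_irrefl {Γ : List Ty} (a : Tm Γ Ty.nat) : RCA0omega Γ (Fm.neg (Fm.lt a a))
  | lt_trans {Γ : List Ty} (a b c : Tm Γ Ty.nat) :
      RCA0omega Γ (Fm.imp (Fm.lt a b) (Fm.imp (Fm.lt b c) (Fm.lt a c)))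
  | lt_total {Γ : List Ty} (a b : Tm Γ Ty.nat) :
      RCA0omega Γ (Fm.or (Fm.lt a b) (Fm.or (Fm.eq a b) (Fm.lt b a)))
  | add_lt {Γ : List Ty} (a b c : Tm Γ Ty.nat) :
      RCA0omega Γ (Fm.imp (Fm.lt a b) (Fm.lt (plus a c) (plus b c)))
  | mul_lt {Γ : List Ty} (a b c : Tm Γ Ty.nat) :
      RCA0omega Γ (Fm.imp (Fm.lt zero c) (Fm.imp (Fm.lt a b) (Fm.lt (times a c) (times b c))))
  | zero_le {Γ : List Ty} (a : Tm Γ Ty.nat) : RCA0omega Γ (Fm.le zero a)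
  | lt_suc {Γ : List Ty} (a b : Tm Γ Ty.nat) :
      RCA0omega Γ (Fm.iff (Fm.lt a (suc b)) (Fm.le a b))
  -- the defining axioms of the combinators
  | K {Γ : List Ty} (σ τ : Ty) (x : Tm Γ σ) (y : Tm Γ τ) :
      RCA0omega Γ (Fm.eqAt σ (Tm.K σ τ ⬝ x ⬝ y) x)
  | S {Γ : List Ty} (ρ σ τ : Ty) (x : Tm Γ (ρ ⇒ σ ⇒ τ)) (y : Tm Γ (ρ ⇒ σ)) (z : Tm Γ ρ) :
      RCA0omega Γ (Fm.eqAt τ (Tm.S ρ σ τ ⬝ x ⬝ y ⬝ z) (x ⬝ z ⬝ (y ⬝ z)))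
  -- the defining axioms of the recursor `R₀` (for no other recursor)
  | R_zero {Γ : List Ty} (f : Tm Γ (Ty.nat ⇒ Ty.nat ⇒ Ty.nat)) (m : Tm Γ Ty.nat) :
      RCA0omega Γ (Fm.eq (R Ty.nat ⬝ f ⬝ m ⬝ zero) m)
  | R_suc {Γ : List Ty} (f : Tm Γ (Ty.nat ⇒ Ty.nat ⇒ Ty.nat)) (m n : Tm Γ Ty.nat) :
      RCA0omega Γ (Fm.eq (R Ty.nat ⬝ f ⬝ m ⬝ suc n) (f ⬝ n ⬝ (R Ty.nat ⬝ f ⬝ m ⬝ n)))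
  -- the axiom of extensionality
  | ext {Γ : List Ty} (ρ τ : Ty) (x y : Tm Γ ρ) (f : Tm Γ (ρ ⇒ τ)) :
      RCA0omega Γ (Fm.imp (Fm.eqAt ρ x y) (Fm.eqAt τ (f ⬝ x) (f ⬝ y)))
  -- induction for quantifier-free formulas
  | qf_ind {Γ : List Ty} (A : Fm (Ty.nat :: Γ)) : A.QF →
      RCA0omega Γ (Fm.imp (A.inst zero)
        (Fm.imp (Fm.all Ty.nat (Fm.imp A (A.subst (Sub.cons (suc v0) (Sub.shift Γ Ty.nat)))))
          (Fm.all Ty.nat A)))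
  -- `QF-AC^{1,0}`; in `A` the variable `v1` is `x` and `v0` is `y`
  | qf_ac {Γ : List Ty} (A : Fm (Ty.nat :: Ty.pure 1 :: Γ)) : A.QF →
      RCA0omega Γ (Fm.imp (Fm.all (Ty.pure 1) (Fm.ex Ty.nat A))
        (Fm.ex (Ty.pure 2) (Fm.all (Ty.pure 1)
          (A.subst (Sub.cons (v1 ⬝ v0)
            (Sub.cons v0 fun _ v => Tm.var v.succ.succ))))))

open Tm in
/-- The axiom `(∃³)`: there is `E ≤₃ 1` such that for all `Y` of type `2`, `Y f = 0` for some `f`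
of type `1` if and only if `E Y = 0`. -/
def exists3Axiom (Γ : List Ty) : Fm Γ :=
  Fm.ex (Ty.pure 3) (Fm.and
    (Fm.all (Ty.pure 2) (Fm.le (v1 ⬝ v0) one))
    (Fm.all (Ty.pure 2)
      (Fm.iff (Fm.ex (Ty.pure 1) (Fm.eq (v1 ⬝ v0) zero)) (Fm.eq (v1 ⬝ v0) zero))))

/-- The system `Z₂^Ω`, that is, `RCA₀^ω + (∃³)`. -/
def Z2Omega (Γ : List Ty) (φ : Fm Γ) : Prop := RCA0omega Γ φ ∨ φ = exists3Axiom Γ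

/-! ### The coding principle -/

namespace Fm

open Tm

variable {Γ : List Ty}

/-- `q <_ℚ r`. -/
def qlt (q r : Tm Γ Ty.nat) : Fm Γ := lt (qltL q r) (qltR q r)

/-- `x <_ℝ y`: there is `n` with `[x](n) + 2 ^ (-n + 1) <_ℚ [y](n)`. -/
def rlt (x y : Tm Γ (Ty.pure 1)) : Fm Γ :=
  ex Ty.nat (qlt (qadd (hat x.wk v0) (qadd (qhalfpow v0) (qhalfpow v0))) (hat y.wk v0))

/-- `x =_ℝ y`: for all `n`, `|[x](n) - [y](n)| ≤ 2 ^ (-n + 1)`. -/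
def req (x y : Tm Γ (Ty.pure 1)) : Fm Γ :=
  all Ty.nat (and
    (neg (qlt (qadd (qhalfpow v0) (qhalfpow v0)) (qsub (hat x.wk v0) (hat y.wk v0))))
    (neg (qlt (qadd (qhalfpow v0) (qhalfpow v0)) (qsub (hat y.wk v0) (hat x.wk v0)))))

/-- `x ∈ B(z, r)` for reals `x, z` and rational `r`: both `x < z + r` and `z < x + r`. -/
def inBall (x z : Tm Γ (Ty.pure 1)) (r : Tm Γ Ty.nat) : Fm Γ :=
  and (rlt x (addRat z r)) (rlt z (addRat x r))

/-- `Y` maps equal reals to equal reals, that is, `Y : ℝ → ℝ`. -/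
def isRealFun (Y : Tm Γ (Ty.pure 1 ⇒ Ty.pure 1)) : Fm Γ :=
  all (Ty.pure 1) (all (Ty.pure 1)
    (imp (req v1 v0) (req (Y.wk.wk ⬝ v1) (Y.wk.wk ⬝ v0))))

/-- `x ∈ Y`, that is, `Y x >_ℝ 0`. -/
def mem (x : Tm Γ (Ty.pure 1)) (Y : Tm Γ (Ty.pure 1 ⇒ Ty.pure 1)) : Fm Γ :=
  rlt (ratReal qzero) (Y ⬝ x)

/-- `B(z, r) ⊆ Y`. -/
def ballSubset (z : Tm Γ (Ty.pure 1)) (r : Tm Γ Ty.nat) (Y : Tm Γ (Ty.pure 1 ⇒ Ty.pure 1)) :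
    Fm Γ :=
  all (Ty.pure 1) (imp (inBall v0 z.wk r.wk) (mem v0 Y.wk))

/-- `Y : ℝ → ℝ` represents an open set: for every `x ∈ Y` there is a rational `r > 0` with
`B(x, r) ⊆ Y`. -/
def isOpenSet (Y : Tm Γ (Ty.pure 1 ⇒ Ty.pure 1)) : Fm Γ :=
  and (isRealFun Y)
    (all (Ty.pure 1) (imp (mem v0 Y.wk)
      (ex Ty.nat (and (qlt qzero v0) (ballSubset v1 v0 Y.wk.wk)))))

/-- The principle `open`: for every open `Y ⊆ ℝ` there is `X ⊆ ℕ` (a `0`-`1`-valued function) such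
that for all `n`, `n ∈ X` if and only if the `n`-th rational ball is contained in `Y`. -/
def openPrinciple : Fm [] :=
  all (Ty.pure 1 ⇒ Ty.pure 1) (imp (isOpenSet v0)
    (ex (Ty.pure 1) (and
      (all Ty.nat (le (v1 ⬝ v0) one))
      (all Ty.nat (iff (eq (v1 ⬝ v0) one)
        (ballSubset (ratReal (ballCentre v0)) (ballRadius v0) v0.wk.wk))))))

end Fm

/-! ### The full type structure -/

/-- The full type structure over `ℕ`. -/
@[reducible] def Ty.Interp : Ty → Type
  | Ty.nat => ℕ
  | σ ⇒ τ => Ty.Interp σ → Ty.Interp τ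

/-- The functional denoted by a closed term of Gödel's system `T`. -/
def Tm.eval : {σ : Ty} → Tm [] σ → σ.Interp
  | _, app s t => (eval s) (eval t)
  | _, zero => (0 : ℕ)
  | _, one => (1 : ℕ)
  | _, add => fun a b : ℕ => (a + b : ℕ)
  | _, mul => fun a b : ℕ => (a * b : ℕ)
  | _, K _ _ => fun x _ => x
  | _, S _ _ _ => fun x y z => x z (y z)
  | _, R σ => fun (f : ℕ → σ.Interp → σ.Interp) (m : σ.Interp) (n : ℕ) =>
      Nat.rec (motive := fun _ => σ.Interp) m f n

open Classical in
/-- The functional `∃³`: on `Y` of type `2` it is `0` if `Y f = 0` for some `f`, and `1`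
otherwise. -/
noncomputable def exists3 : (Ty.pure 3).Interp :=
  fun Y : (ℕ → ℕ) → ℕ => (if ∃ f : ℕ → ℕ, Y f = 0 then 0 else 1 : ℕ)

/-- The rational number coded by a natural number: `⟨⟨p, m⟩, d⟩` codes `(p - m) / (d + 1)`. -/
def ratOf (c : ℕ) : ℚ :=
  (((c.unpair.1.unpair.1 : ℕ) : ℚ) - ((c.unpair.1.unpair.2 : ℕ) : ℚ)) / ((c.unpair.2 : ℕ) + 1)

/-- The least `k < n` with `|f k - f (k + 1)| ≥ 2 ^ (-(k + 1))`, and `n` if there is none. -/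
def hatIndex (f : ℕ → ℕ) : ℕ → ℕ
  | 0 => 0
  | n + 1 =>
    if hatIndex f n = n ∧ |ratOf (f n) - ratOf (f (n + 1))| < 1 / 2 ^ (n + 1) then n + 1
    else hatIndex f n

/-- `f` codes the real number `x`, the limit of the `hat` of `f`. -/
def CodesReal (f : ℕ → ℕ) (x : ℝ) : Prop :=
  Filter.Tendsto (fun n => ((ratOf (f (hatIndex f n)) : ℚ) : ℝ)) Filter.atTop (nhds x)

/-- `Y` codes the function `F : ℝ → ℝ`. -/
def CodesFun (Y : (ℕ → ℕ) → (ℕ → ℕ)) (F : ℝ → ℝ) : Prop :=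
  ∀ (f : ℕ → ℕ) (x : ℝ), CodesReal f x → CodesReal (Y f) (F x)

/-- A `Ψ`-functional: if `Y` codes `F : ℝ → ℝ` and the set `{x | F x > 0}` represented by it is
open, then `Ψ Y` consists of two sequences `a = Ψ Y 0` and `r = Ψ Y 1` of (codes of) rationals,
`r n ≥ 0`, such that this set is the union of the open balls `B(a n, r n)`. -/
def IsPsiFunctional (Ψ : ((ℕ → ℕ) → (ℕ → ℕ)) → ℕ → ℕ → ℕ) : Prop :=
  ∀ (Y : (ℕ → ℕ) → (ℕ → ℕ)) (F : ℝ → ℝ), CodesFun Y F → IsOpen {x : ℝ | 0 < F x} →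
    (∀ n : ℕ, 0 ≤ ratOf (Ψ Y 1 n)) ∧
    {x : ℝ | 0 < F x} =
      ⋃ n : ℕ, Metric.ball ((ratOf (Ψ Y 0 n) : ℚ) : ℝ) ((ratOf (Ψ Y 1 n) : ℚ) : ℝ)

end FinTypes

/-! Both parts rest on one fact: `∃³` decides every formula whose quantifiers all range over types
`0` and `1`, whatever the types of its free variables. By recursion on such a formula, `Tm.dec`
builds a term for its truth value (`0` for true, `1` for false) out of `E`, playing the role of
`∃³`, and a functional `D` that decides `f 0 < f 1`. Implication is a case distinction. For a
quantifier over type `1`, `E` looks for a zero of a functional that vanishes exactly at the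
counterexamples. A quantifier over numbers becomes one over type `1` by reading `n` as `f 0`. The
inclusion of a ball in `Y` is a formula of this kind, with `Y` as a parameter.

The term is verified twice. Inside the theory, `Proves.dec` derives that it is the truth value of
the formula. This yields comprehension for second-order formulas (`Proves.compr`), of which `open`
is an instance. In the full type structure, `Tm.val_dec_eq_zero` says that the term vanishes exactly
when the formula is true. The closed term `psiTerm` then lists all rational balls, with radius `0`
in place of the true one when the ball is not contained in the set; an open set is the union of the
rational balls inside it.

Derivations in the object theory are made manageable by `Proves.of_val`, a completeness theorem for
propositional reasoning: a formula is derivable as soon as it holds in all valuations that respect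
`⊥` and `→` and contain all derivable formulas. Connectives can then be handled in the metatheory,
and only quantifier steps need derivations. -/

namespace FinTypes

section

/-! ### Substitution -/

variable {Γ Δ Ξ : List Ty} {σ τ ρ : Ty}

namespace Tm

theorem subst_subst (θ : Sub Γ Δ) (η : Sub Δ Ξ) (t : Tm Γ σ) :
    (t.subst θ).subst η = t.subst fun τ v => (θ τ v).subst η := by
  induction t <;> simp_all [subst]

@[simp]
theorem subst_id (t : Tm Γ σ) : t.subst (Sub.id Γ) = t := by
  induction t <;> simp_all [subst, Sub.id]

@[simp]
theorem wk_subst_cons (t : Tm Γ σ) (u : Tm Δ τ) (θ : Sub Γ Δ) :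
    t.wk.subst (Sub.cons u θ) = t.subst θ := by
  rw [wk, subst_subst]; rfl

@[simp]
theorem wk_subst_lift (t : Tm Γ σ) (θ : Sub Γ Δ) :
    t.wk.subst (Sub.lift (σ := τ) θ) = (t.subst θ).wk := by
  rw [Sub.lift, wk_subst_cons, wk, subst_subst]; rfl

@[simp]
theorem v0_subst_cons (u : Tm Δ τ) (θ : Sub Γ Δ) : v0.subst (Sub.cons u θ) = u := rfl

@[simp]
theorem v0_subst_lift (θ : Sub Γ Δ) : (v0 (σ := σ)).subst (Sub.lift θ) = v0 := rfl

theorem v1_eq_wk : (v1 : Tm (τ :: σ :: Γ) σ) = v0.wk := rfl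

@[simp]
theorem v1_subst_lift (θ : Sub (σ :: Γ) Δ) :
    (v1 (σ := σ) (τ := τ)).subst (Sub.lift θ) = (v0.subst θ).wk := rfl

@[simp]
theorem app_subst (θ : Sub Γ Δ) (s : Tm Γ (σ ⇒ τ)) (t : Tm Γ σ) :
    (s ⬝ t).subst θ = s.subst θ ⬝ t.subst θ := rfl

@[simp] theorem zero_subst (θ : Sub Γ Δ) : zero.subst θ = zero := rfl
@[simp] theorem one_subst (θ : Sub Γ Δ) : one.subst θ = one := rfl
@[simp] theorem K_subst (θ : Sub Γ Δ) : (K σ τ).subst θ = K σ τ := rfl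
@[simp] theorem R_subst (θ : Sub Γ Δ) : (R σ).subst θ = R σ := rfl

end Tm

namespace Sub

open Tm

theorem lift_comp (θ : Sub Γ Δ) (η : Sub Δ Ξ) :
    (fun τ v => (lift (σ := σ) θ τ v).subst (lift η)) = lift fun τ v => (θ τ v).subst η := by
  funext τ v
  cases v with
  | zero => rfl
  | succ v => exact wk_subst_lift _ _

theorem lift_id : lift (σ := σ) (id Γ) = id (σ :: Γ) := by
  funext τ v
  cases v <;> rfl

theorem lift_cons_id (u : Tm Δ σ) (θ : Sub Γ Δ) :
    (fun τ v => (lift θ τ v).subst (cons u (id Δ))) = cons u θ := by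
  funext τ v
  cases v with
  | zero => rfl
  | succ v => exact (wk_subst_cons _ _ _).trans (subst_id _)

theorem cons_v0_shift : cons v0 (shift Γ σ) = id (σ :: Γ) := by
  funext τ v
  cases v <;> rfl

end Sub

/-! ### Substitution in formulas -/

namespace Fm

open Tm

theorem subst_subst (φ : Fm Γ) : ∀ {Δ Ξ : List Ty} (θ : Sub Γ Δ) (η : Sub Δ Ξ),
    (φ.subst θ).subst η = φ.subst fun τ v => (θ τ v).subst η := by
  induction φ with
  | eq s t => intros; simp [subst, Tm.subst_subst]
  | lt s t => intros; simp [subst, Tm.subst_subst]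
  | bot => intros; rfl
  | imp φ ψ h₁ h₂ => intros; simp [subst, h₁, h₂]
  | all σ φ h => intros; simp [subst, h, Sub.lift_comp]

@[simp]
theorem subst_id (φ : Fm Γ) : φ.subst (Sub.id Γ) = φ := by
  induction φ with
  | eq s t => simp [subst]
  | lt s t => simp [subst]
  | bot => rfl
  | imp φ ψ h₁ h₂ => simp [subst, h₁, h₂]
  | all σ φ h => simp [subst, h, Sub.lift_id]

theorem subst_lift_inst (φ : Fm (σ :: Γ)) (θ : Sub Γ Δ) (u : Tm Δ σ) :
    (φ.subst (Sub.lift θ)).inst u = φ.subst (Sub.cons u θ) := by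
  rw [inst, subst_subst, Sub.lift_cons_id]

@[simp] theorem eq_subst (θ : Sub Γ Δ) (s t : Tm Γ Ty.nat) :
    (eq s t).subst θ = eq (s.subst θ) (t.subst θ) := rfl
@[simp] theorem lt_subst (θ : Sub Γ Δ) (s t : Tm Γ Ty.nat) :
    (lt s t).subst θ = lt (s.subst θ) (t.subst θ) := rfl
@[simp] theorem bot_subst (θ : Sub Γ Δ) : bot.subst θ = bot := rfl
@[simp] theorem imp_subst (θ : Sub Γ Δ) (φ ψ : Fm Γ) :
    (imp φ ψ).subst θ = imp (φ.subst θ) (ψ.subst θ) := rfl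
@[simp] theorem all_subst (θ : Sub Γ Δ) (φ : Fm (σ :: Γ)) :
    (all σ φ).subst θ = all σ (φ.subst θ.lift) := rfl
@[simp] theorem neg_subst (θ : Sub Γ Δ) (φ : Fm Γ) : (neg φ).subst θ = neg (φ.subst θ) := rfl
@[simp] theorem and_subst (θ : Sub Γ Δ) (φ ψ : Fm Γ) :
    (and φ ψ).subst θ = and (φ.subst θ) (ψ.subst θ) := rfl
@[simp] theorem iff_subst (θ : Sub Γ Δ) (φ ψ : Fm Γ) :
    (iff φ ψ).subst θ = iff (φ.subst θ) (ψ.subst θ) := rfl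
@[simp] theorem ex_subst (θ : Sub Γ Δ) (φ : Fm (σ :: Γ)) :
    (ex σ φ).subst θ = ex σ (φ.subst θ.lift) := rfl
@[simp] theorem le_subst (θ : Sub Γ Δ) (s t : Tm Γ Ty.nat) :
    (le s t).subst θ = le (s.subst θ) (t.subst θ) := rfl

theorem eqAt_subst (σ : Ty) : ∀ {Γ Δ : List Ty} (θ : Sub Γ Δ) (s t : Tm Γ σ),
    (eqAt σ s t).subst θ = eqAt σ (s.subst θ) (t.subst θ) := by
  induction σ with
  | nat => intros; rfl
  | arr σ τ _ ih => intros; simp [eqAt, ih]; rfl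

end Fm

/-! ### Renamings -/

/-- The substitution maps variables to variables. -/
def Sub.IsRen (θ : Sub Γ Δ) : Prop := ∀ τ (v : Var Γ τ), ∃ w, θ τ v = Tm.var w

theorem Sub.IsRen.lift {θ : Sub Γ Δ} (h : θ.IsRen) : (Sub.lift (σ := σ) θ).IsRen := by
  intro τ v
  cases v with
  | zero => exact ⟨_, rfl⟩
  | succ v =>
    obtain ⟨w, hw⟩ := h _ v
    exact ⟨w.succ, by simp [Sub.lift, Sub.cons, hw, Tm.wk, Tm.subst]⟩

theorem Sub.isRen_shift : (Sub.shift Γ σ).IsRen := fun _ v => ⟨v.succ, rfl⟩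

namespace Tm

/-- The restriction to renamings is essential for a syntactic identity: `lam` turns an older
variable into a constant function by `K`, but would break up an application put in its place by `S`.
-/
theorem lam_subst {θ : Sub Γ Δ} (h : θ.IsRen) (t : Tm (ρ :: Γ) σ) :
    (lam t).subst θ = lam (t.subst θ.lift) := by
  induction t with
  | var v =>
    cases v with
    | zero => rfl
    | succ v =>
      obtain ⟨w, hw⟩ := h _ v
      simp [lam, subst, Sub.lift, Sub.cons, hw, wk]
  | app s t hs ht => simp [lam, subst, hs, ht]
  | _ => rfl

/-! ### Defined terms under renamings -/

section Renaming

variable {θ : Sub Γ Δ}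

@[simp] theorem plus_subst (s t : Tm Γ Ty.nat) :
    (plus s t).subst θ = plus (s.subst θ) (t.subst θ) := rfl
@[simp] theorem times_subst (s t : Tm Γ Ty.nat) :
    (times s t).subst θ = times (s.subst θ) (t.subst θ) := rfl
@[simp] theorem suc_subst (s : Tm Γ Ty.nat) : (suc s).subst θ = suc (s.subst θ) := rfl

/-- The `lam` in `primrec` is what confines this lemma, and those below that build on it, to
renamings. -/
theorem primrec_subst (h : θ.IsRen) (a n : Tm Γ Ty.nat) (b : Tm (Ty.nat :: Ty.nat :: Γ) Ty.nat) :
    (primrec a b n).subst θ = primrec (a.subst θ) (b.subst θ.lift.lift) (n.subst θ) := by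
  simp [primrec, lam_subst, h, h.lift]

theorem pred_subst (h : θ.IsRen) (n : Tm Γ Ty.nat) : (pred n).subst θ = pred (n.subst θ) := by
  simp [pred, primrec_subst h]; rfl

theorem monus_subst (h : θ.IsRen) (s t : Tm Γ Ty.nat) :
    (monus s t).subst θ = monus (s.subst θ) (t.subst θ) := by
  simp [monus, primrec_subst h, pred_subst h.lift.lift]

theorem ifz_subst (h : θ.IsRen) (c a b : Tm Γ Ty.nat) :
    (ifz c a b).subst θ = ifz (c.subst θ) (a.subst θ) (b.subst θ) := by
  simp [ifz, primrec_subst h]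

theorem ltz_subst (h : θ.IsRen) (s t : Tm Γ Ty.nat) :
    (ltz s t).subst θ = ltz (s.subst θ) (t.subst θ) := by
  simp [ltz, monus_subst h]

theorem pow2_subst (h : θ.IsRen) (n : Tm Γ Ty.nat) : (pow2 n).subst θ = pow2 (n.subst θ) := by
  simp [pow2, primrec_subst h]

theorem isqrt_subst (h : θ.IsRen) (n : Tm Γ Ty.nat) :
    (isqrt n).subst θ = isqrt (n.subst θ) := by
  simp [isqrt, primrec_subst h, ifz_subst h.lift.lift, ltz_subst h.lift.lift, v1_eq_wk]

theorem pair_subst (h : θ.IsRen) (a b : Tm Γ Ty.nat) :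
    (pair a b).subst θ = pair (a.subst θ) (b.subst θ) := by
  simp [pair, ifz_subst h, ltz_subst h]

theorem excess_subst (h : θ.IsRen) (n : Tm Γ Ty.nat) :
    (excess n).subst θ = excess (n.subst θ) := by
  simp [excess, monus_subst h, isqrt_subst h]

theorem fst_subst (h : θ.IsRen) (n : Tm Γ Ty.nat) : (fst n).subst θ = fst (n.subst θ) := by
  simp [fst, ifz_subst h, ltz_subst h, isqrt_subst h, excess_subst h]

theorem snd_subst (h : θ.IsRen) (n : Tm Γ Ty.nat) : (snd n).subst θ = snd (n.subst θ) := by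
  simp [snd, ifz_subst h, ltz_subst h, isqrt_subst h, excess_subst h, monus_subst h]

theorem qmk_subst (h : θ.IsRen) (p m d : Tm Γ Ty.nat) :
    (qmk p m d).subst θ = qmk (p.subst θ) (m.subst θ) (d.subst θ) := by
  simp [qmk, pair_subst h, pred_subst h]

theorem qpos_subst (h : θ.IsRen) (q : Tm Γ Ty.nat) : (qpos q).subst θ = qpos (q.subst θ) := by
  simp [qpos, fst_subst h]

theorem qneg_subst (h : θ.IsRen) (q : Tm Γ Ty.nat) : (qneg q).subst θ = qneg (q.subst θ) := by
  simp [qneg, fst_subst h, snd_subst h]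

theorem qden_subst (h : θ.IsRen) (q : Tm Γ Ty.nat) : (qden q).subst θ = qden (q.subst θ) := by
  simp [qden, snd_subst h]

theorem qzero_subst (h : θ.IsRen) : qzero.subst θ = qzero := by
  simp [qzero, qmk_subst h]

theorem qhalfpow_subst (h : θ.IsRen) (n : Tm Γ Ty.nat) :
    (qhalfpow n).subst θ = qhalfpow (n.subst θ) := by
  simp [qhalfpow, qmk_subst h, pow2_subst h]

theorem qadd_subst (h : θ.IsRen) (q r : Tm Γ Ty.nat) :
    (qadd q r).subst θ = qadd (q.subst θ) (r.subst θ) := by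
  simp [qadd, qmk_subst h, qpos_subst h, qneg_subst h, qden_subst h]

theorem qsub_subst (h : θ.IsRen) (q r : Tm Γ Ty.nat) :
    (qsub q r).subst θ = qsub (q.subst θ) (r.subst θ) := by
  simp [qsub, qadd_subst h, qmk_subst h, qpos_subst h, qneg_subst h, qden_subst h]

theorem qltL_subst (h : θ.IsRen) (q r : Tm Γ Ty.nat) :
    (qltL q r).subst θ = qltL (q.subst θ) (r.subst θ) := by
  simp [qltL, qpos_subst h, qneg_subst h, qden_subst h]

theorem qltR_subst (h : θ.IsRen) (q r : Tm Γ Ty.nat) :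
    (qltR q r).subst θ = qltR (q.subst θ) (r.subst θ) := by
  simp [qltR, qpos_subst h, qneg_subst h, qden_subst h]

theorem qltz_subst (h : θ.IsRen) (q r : Tm Γ Ty.nat) :
    (qltz q r).subst θ = qltz (q.subst θ) (r.subst θ) := by
  simp [qltz, qltL_subst h, qltR_subst h, ltz_subst h]

theorem hatIdx_subst (h : θ.IsRen) (f : Tm Γ (Ty.pure 1)) (n : Tm Γ Ty.nat) :
    (hatIdx f n).subst θ = hatIdx (f.subst θ) (n.subst θ) := by
  have h' := h.lift (σ := Ty.nat) |>.lift (σ := Ty.nat)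
  simp [hatIdx, primrec_subst h, ifz_subst h', monus_subst h', qltz_subst h', qsub_subst h',
    qhalfpow_subst h', v1_eq_wk]

theorem hat_subst (h : θ.IsRen) (x : Tm Γ (Ty.pure 1)) (n : Tm Γ Ty.nat) :
    (hat x n).subst θ = hat (x.subst θ) (n.subst θ) := by
  simp [hat, hatIdx_subst h]

@[simp] theorem ratReal_subst (q : Tm Γ Ty.nat) : (ratReal q).subst θ = ratReal (q.subst θ) := rfl

theorem addRat_subst (h : θ.IsRen) (x : Tm Γ (Ty.pure 1)) (q : Tm Γ Ty.nat) :
    (addRat x q).subst θ = addRat (x.subst θ) (q.subst θ) := by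
  simp [addRat, lam_subst h, qadd_subst h.lift, hat_subst h.lift]

theorem ballCentre_subst (h : θ.IsRen) (n : Tm Γ Ty.nat) :
    (ballCentre n).subst θ = ballCentre (n.subst θ) := fst_subst h n

theorem ballRadius_subst (h : θ.IsRen) (n : Tm Γ Ty.nat) :
    (ballRadius n).subst θ = ballRadius (n.subst θ) := by
  simp [ballRadius, qmk_subst h, fst_subst h, snd_subst h]

end Renaming

end Tm

namespace Fm

open Tm

variable {θ : Sub Γ Δ}

theorem rlt_subst (h : θ.IsRen) (x y : Tm Γ (Ty.pure 1)) :
    (rlt x y).subst θ = rlt (x.subst θ) (y.subst θ) := by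
  simp [rlt, qlt, qltL_subst h.lift, qltR_subst h.lift, qadd_subst h.lift, hat_subst h.lift,
    qhalfpow_subst h.lift]

theorem ballSubset_subst (h : θ.IsRen) (z : Tm Γ (Ty.pure 1)) (r : Tm Γ Ty.nat)
    (Y : Tm Γ (Ty.pure 1 ⇒ Ty.pure 1)) :
    (ballSubset z r Y).subst θ = ballSubset (z.subst θ) (r.subst θ) (Y.subst θ) := by
  simp [ballSubset, inBall, mem, rlt_subst h.lift, addRat_subst h.lift, qzero_subst h.lift]

end Fm

end

/-! ### Classical propositional reasoning -/

section Valuations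

variable {Ax : ∀ Γ : List Ty, Fm Γ → Prop} {Γ : List Ty} {σ τ : Ty}

namespace Proves

theorem mono {Δ Δ' : List (Fm Γ)} {φ : Fm Γ} (h : Proves Ax Δ φ) (hΔ : Δ ⊆ Δ') :
    Proves Ax Δ' φ := by
  induction h with
  | ax h => exact ax h
  | hyp h => exact hyp (hΔ h)
  | impI _ ih => exact impI (ih (List.cons_subset_cons _ hΔ))
  | impE _ _ ih₁ ih₂ => exact impE (ih₁ hΔ) (ih₂ hΔ)
  | raa _ ih => exact raa (ih (List.cons_subset_cons _ hΔ))
  | allI _ ih => exact allI (ih (List.map_subset _ hΔ))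
  | allE _ t ih => exact allE (ih hΔ) t

end Proves

/-- The truth valuations of formulas that respect `⊥` and `→` and satisfy everything derivable
from `Δ`. -/
structure Val (Ax : ∀ Γ : List Ty, Fm Γ → Prop) {Γ : List Ty} (Δ : List (Fm Γ)) where
  holds : Fm Γ → Prop
  bot : ¬ holds Fm.bot
  imp : ∀ φ ψ, holds (Fm.imp φ ψ) ↔ (holds φ → holds ψ)
  thm : ∀ φ, Proves Ax Δ φ → holds φ

/-- A set of formulas is consistent relative to `Δ`. -/
def Consistent (Ax : ∀ Γ : List Ty, Fm Γ → Prop) (Δ : List (Fm Γ)) (S : Set (Fm Γ)) : Prop :=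
  ∀ L : List (Fm Γ), (∀ φ ∈ L, φ ∈ S) → ¬ Proves Ax (L ++ Δ) Fm.bot

/-- A derivation of `⊥` uses finitely many hypotheses, so an inconsistency already occurs in a
finite subset. -/
theorem isOfFiniteCharacter_consistent (Δ : List (Fm Γ)) :
    Order.IsOfFiniteCharacter {S | Consistent Ax Δ S} := by
  intro S
  refine ⟨fun h T hT _ L hL => h L fun φ hφ => hT (hL φ hφ), fun h L hL => ?_⟩
  exact h {φ | φ ∈ L} hL (List.finite_toSet L) L fun _ hφ => hφ

/-- Lindenbaum's argument: if `φ` is not derivable, then `¬φ` is consistent and lies in a maximal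
consistent set, whose consequences form a valuation that refutes `φ`. -/
theorem Proves.of_val {Δ : List (Fm Γ)} {φ : Fm Γ} (h : ∀ v : Val Ax Δ, v.holds φ) :
    Proves Ax Δ φ := by
  by_contra hφ
  have h₀ : Consistent Ax Δ {Fm.neg φ} := by
    intro L hL hbot
    refine hφ (raa (hbot.mono ?_))
    intro ψ hψ
    rcases List.mem_append.1 hψ with hψ | hψ
    · simpa using Or.inl (hL ψ hψ)
    · exact List.mem_cons_of_mem _ hψ
  obtain ⟨S, hS, hmax⟩ := (isOfFiniteCharacter_consistent Δ).exists_maximal h₀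
  have hcon : Consistent Ax Δ S := hmax.prop
  let Der : Fm Γ → Prop := fun ψ => ∃ L : List (Fm Γ), (∀ χ ∈ L, χ ∈ S) ∧ Proves Ax (L ++ Δ) ψ
  have hmp : ∀ ψ χ, Der (Fm.imp ψ χ) → Der ψ → Der χ := by
    rintro ψ χ ⟨L, hL, h₁⟩ ⟨L', hL', h₂⟩
    refine ⟨L ++ L', fun θ hθ => (List.mem_append.1 hθ).elim (hL θ) (hL' θ), ?_⟩
    exact impE (h₁.mono (by simp)) (h₂.mono (by simp))
  have hbot : ¬ Der Fm.bot := fun ⟨L, hL, h₁⟩ => hcon L hL h₁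
  have hneg : ∀ ψ, ¬ Der ψ → Der (Fm.neg ψ) := by
    intro ψ hψ
    -- A refutation using `¬ψ` would give, by `raa`, a derivation of `ψ` from the remaining
    -- hypotheses, which lie in `S`.
    have h₁ : Consistent Ax Δ (insert (Fm.neg ψ) S) := by
      classical
      intro L hL hb
      refine hψ ⟨L.filter (· ∈ S), by simp, raa (hb.mono ?_)⟩
      intro χ hχ
      rcases List.mem_append.1 hχ with hχ | hχ
      · rcases hL χ hχ with rfl | h₂
        · simp
        · simp [hχ, h₂]
      · simp [hχ]
    have h₂ : Fm.neg ψ ∈ S := hmax.le_of_ge h₁ (Set.subset_insert _ _) (Set.mem_insert _ _)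
    exact ⟨[Fm.neg ψ], by simpa using h₂, hyp (by simp)⟩
  let v : Val Ax Δ :=
    { holds := Der
      bot := hbot
      imp := by
        refine fun ψ χ => ⟨hmp ψ χ, fun h₁ => ?_⟩
        by_cases hψ : Der ψ
        · obtain ⟨L, hL, h₂⟩ := h₁ hψ
          exact ⟨L, hL, impI (h₂.mono (by simp))⟩
        · obtain ⟨L, hL, h₂⟩ := hneg ψ hψ
          refine ⟨L, hL, impI (raa (impE (φ := ψ) (h₂.mono ?_) (hyp (by simp))))⟩
          exact fun x hx => by simp_all
      thm := fun ψ h₁ => ⟨[], by simp, h₁⟩ }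
  refine hbot (hmp φ _ ⟨[Fm.neg φ], ?_, hyp (List.mem_cons_self ..)⟩ (h v))
  simpa using hS

namespace Val

variable {Δ : List (Fm Γ)} (v : Val Ax Δ)

attribute [simp] Val.bot Val.imp

@[simp] theorem neg (φ : Fm Γ) : v.holds (Fm.neg φ) ↔ ¬ v.holds φ := by simp [Fm.neg]
@[simp] theorem and (φ ψ : Fm Γ) : v.holds (Fm.and φ ψ) ↔ v.holds φ ∧ v.holds ψ := by
  simp [Fm.and]
@[simp] theorem or (φ ψ : Fm Γ) : v.holds (Fm.or φ ψ) ↔ v.holds φ ∨ v.holds ψ := by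
  simp [Fm.or, or_iff_not_imp_left]
@[simp] theorem iff (φ ψ : Fm Γ) : v.holds (Fm.iff φ ψ) ↔ (v.holds φ ↔ v.holds ψ) := by
  simp [Fm.iff, iff_def]
@[simp] theorem le (s t : Tm Γ Ty.nat) :
    v.holds (Fm.le s t) ↔ v.holds (Fm.lt s t) ∨ v.holds (Fm.eq s t) := by simp [Fm.le]
theorem ex (φ : Fm (σ :: Γ)) :
    v.holds (Fm.ex σ φ) ↔ ¬ v.holds (Fm.all σ (Fm.neg φ)) := by simp [Fm.ex]

theorem hyp {φ : Fm Γ} (h : φ ∈ Δ) : v.holds φ := v.thm _ (Proves.hyp h)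

theorem inst {φ : Fm (σ :: Γ)} (h : v.holds (Fm.all σ φ)) (t : Tm Γ σ) : v.holds (φ.inst t) :=
  (v.imp _ _).1 (v.thm _ (Proves.impI (Proves.allE (Proves.hyp (by simp)) t))) h

/-- A valuation need not read `∀` as truth of all instances, so this has to come from a derivation.
It is the means of transporting a pointwise argument, made in valuations over the extended context,
under a quantifier. -/
theorem all_mp {φ ψ : Fm (σ :: Γ)} (h : v.holds (Fm.all σ (Fm.imp φ ψ)))
    (h' : v.holds (Fm.all σ φ)) : v.holds (Fm.all σ ψ) := by
  have key : Proves Ax Δ (Fm.imp (Fm.all σ (Fm.imp φ ψ)) (Fm.imp (Fm.all σ φ) (Fm.all σ ψ))) := by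
    refine .impI (.impI (.allI (.of_val fun w => ?_)))
    have h₁ := w.inst (σ := σ) (w.hyp (φ := (Fm.all σ (Fm.imp φ ψ)).wk) (by simp)) Tm.v0
    have h₂ := w.inst (σ := σ) (w.hyp (φ := (Fm.all σ φ).wk) (by simp)) Tm.v0
    rw [Fm.subst_lift_inst, Sub.cons_v0_shift, Fm.subst_id] at h₁ h₂
    exact (w.imp _ _).1 h₁ h₂
  simpa [h, h'] using v.thm _ key

theorem all_congr {φ ψ : Fm (σ :: Γ)} (h : v.holds (Fm.all σ (Fm.iff φ ψ))) :
    v.holds (Fm.all σ φ) ↔ v.holds (Fm.all σ ψ) := by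
  constructor
  · refine v.all_mp (v.all_mp (v.thm _ (.allI (.of_val fun w => ?_))) h)
    simp +contextual
  · refine v.all_mp (v.all_mp (v.thm _ (.allI (.of_val fun w => ?_))) h)
    simp +contextual

/-- From `∀ x φ(x)` infer `∀ y φ(t(y))`. -/
theorem all_comp {φ : Fm (σ :: Γ)} (t : Tm (τ :: Γ) σ) (h : v.holds (Fm.all σ φ)) :
    v.holds (Fm.all τ (φ.subst (Sub.cons t (Sub.shift Γ τ)))) := by
  have key : Proves Ax Δ
      (Fm.imp (Fm.all σ φ) (Fm.all τ (φ.subst (Sub.cons t (Sub.shift Γ τ))))) := by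
    refine .impI (.allI (.of_val fun w => ?_))
    have h₁ := w.inst (σ := σ) (w.hyp (φ := (Fm.all σ φ).wk) (by simp)) t
    rwa [Fm.subst_lift_inst] at h₁
  exact (v.imp _ _).1 (v.thm _ key) h

theorem ex_intro {φ : Fm (σ :: Γ)} (t : Tm Γ σ) (h : v.holds (φ.inst t)) :
    v.holds (Fm.ex σ φ) := by
  rw [v.ex]
  intro h'
  exact (v.neg _).1 (v.inst h' t) h

end Val

theorem Proves.exE {Δ : List (Fm Γ)} {φ : Fm (σ :: Γ)} {ψ : Fm Γ} (h : Proves Ax Δ (Fm.ex σ φ))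
    (h' : Proves Ax (φ :: Δ.map Fm.wk) ψ.wk) : Proves Ax Δ ψ := by
  refine raa (impE (h.mono (by simp)) (allI (impI ?_)))
  refine impE (φ := ψ.wk) (hyp ?_) (h'.mono ?_)
  · simp [Fm.neg, Fm.wk]
  · intro x hx; simp_all; tauto

end Valuations

/-! ### Equality and the combinators -/

section Equality

open Tm

variable {Γ : List Ty} {Δ : List (Fm Γ)} {ρ σ τ : Ty}

theorem Proves.base {φ : Fm Γ} (h : RCA0omega Γ φ) : Proves Z2Omega Δ φ := .ax (.inl h)

namespace Fm

theorem wk_eqAt (s t : Tm Γ σ) : (eqAt σ s t).wk (σ := τ) = eqAt σ s.wk t.wk :=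
  eqAt_subst _ _ _ _

theorem eqAt_inst (s t : Tm Γ (σ ⇒ τ)) (u : Tm Γ σ) :
    (eqAt τ (s.wk ⬝ var Var.zero) (t.wk ⬝ var Var.zero)).inst u = eqAt τ (s ⬝ u) (t ⬝ u) := by
  rw [inst, eqAt_subst]
  simp [Tm.subst, Sub.cons]

end Fm

namespace Proves

theorem eqAt_app {s t : Tm Γ (σ ⇒ τ)} (h : Proves Z2Omega Δ (Fm.eqAt _ s t)) (u : Tm Γ σ) :
    Proves Z2Omega Δ (Fm.eqAt τ (s ⬝ u) (t ⬝ u)) := by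
  rw [← Fm.eqAt_inst]
  exact allE h u

theorem eqAt_refl (t : Tm Γ σ) : Proves Z2Omega Δ (Fm.eqAt σ t t) := by
  induction σ generalizing Γ with
  | nat => exact base (.eq_refl _)
  | arr σ τ _ ih => exact allI (ih _)

theorem eqAt_trans_imp (s t u : Tm Γ σ) :
    Proves Z2Omega Δ
      (Fm.imp (Fm.eqAt σ s t) (Fm.imp (Fm.eqAt σ t u) (Fm.eqAt σ s u))) := by
  induction σ generalizing Γ with
  | nat => exact base (.eq_trans _ _ _)
  | arr σ τ _ ih =>
    refine impI (impI (allI (impE (impE (ih _ (t.wk ⬝ var Var.zero) _)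
      (eqAt_app (hyp ?_) _)) (eqAt_app (hyp ?_) _)))) <;>
    · rw [← Fm.wk_eqAt]
      simp

theorem eqAt_trans {s t u : Tm Γ σ} (h : Proves Z2Omega Δ (Fm.eqAt σ s t))
    (h' : Proves Z2Omega Δ (Fm.eqAt σ t u)) : Proves Z2Omega Δ (Fm.eqAt σ s u) :=
  impE (impE (eqAt_trans_imp _ _ _) h) h'

/-- Replacing the function uses only the definition of equality at arrow types; replacing the
argument is the axiom of extensionality. -/
theorem eqAt_congr {s s' : Tm Γ (σ ⇒ τ)} {t t' : Tm Γ σ}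
    (h : Proves Z2Omega Δ (Fm.eqAt _ s s')) (h' : Proves Z2Omega Δ (Fm.eqAt _ t t')) :
    Proves Z2Omega Δ (Fm.eqAt τ (s ⬝ t) (s' ⬝ t')) :=
  eqAt_trans (eqAt_app h t) (impE (base (.ext _ _ _ _ _)) h')

theorem eqAt_K (s : Tm Γ σ) (t : Tm Γ τ) : Proves Z2Omega Δ (Fm.eqAt σ (K σ τ ⬝ s ⬝ t) s) :=
  base (.K _ _ _ _)

/-- Each clause of `lam` is undone by the axioms for `K` and `S`; equalities of subterms pass
through an application by congruence. -/
theorem beta (s : Tm (ρ :: Γ) σ) (t : Tm Γ ρ) :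
    Proves Z2Omega Δ (Fm.eqAt σ (lam s ⬝ t) (s.subst (Sub.cons t (Sub.id Γ)))) := by
  induction s with
  | var v =>
    cases v with
    | zero => exact eqAt_trans (base (.S _ _ _ _ _ _)) (eqAt_K _ _)
    | succ v => exact eqAt_K _ _
  | app s u hs hu => exact eqAt_trans (base (.S _ _ _ _ _ _)) (eqAt_congr hs hu)
  | _ => exact eqAt_K _ _

theorem eqAt_subst_congr {Ξ : List Ty} (s : Tm Ξ σ) {θ θ' : Sub Ξ Γ}
    (h : ∀ τ v, Proves Z2Omega Δ (Fm.eqAt τ (θ τ v) (θ' τ v))) :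
    Proves Z2Omega Δ (Fm.eqAt σ (s.subst θ) (s.subst θ')) := by
  induction s with
  | var v => exact h _ v
  | app s t hs ht => exact eqAt_congr hs ht
  | _ => exact eqAt_refl _

end Proves

namespace Val

variable (v : Val Z2Omega Δ)

theorem base {φ : Fm Γ} (h : RCA0omega Γ φ) : v.holds φ := v.thm _ (.base h)

theorem eq_trans {a b c : Tm Γ Ty.nat} (h : v.holds (Fm.eq a b)) (h' : v.holds (Fm.eq b c)) :
    v.holds (Fm.eq a c) := by
  simpa [h, h'] using v.base (.eq_trans a b c)

theorem eq_symm {a b : Tm Γ Ty.nat} (h : v.holds (Fm.eq a b)) : v.holds (Fm.eq b a) := by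
  simpa [h] using v.base (.eq_symm a b)

theorem eq_congr_left {a b : Tm Γ Ty.nat} (h : v.holds (Fm.eq a b)) (c : Tm Γ Ty.nat) :
    v.holds (Fm.eq a c) ↔ v.holds (Fm.eq b c) :=
  ⟨v.eq_trans (v.eq_symm h), v.eq_trans h⟩

theorem lt_congr {a a' b b' : Tm Γ Ty.nat} (ha : v.holds (Fm.eq a a'))
    (hb : v.holds (Fm.eq b b')) : v.holds (Fm.lt a b) ↔ v.holds (Fm.lt a' b') := by
  have h₁ := v.base (.lt_congr a a' b b')
  have h₂ := v.base (.lt_congr a' a b' b)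
  simp only [Val.imp] at h₁ h₂
  exact ⟨h₁ ha hb, h₂ (v.eq_symm ha) (v.eq_symm hb)⟩

theorem lt_irrefl (a : Tm Γ Ty.nat) : ¬ v.holds (Fm.lt a a) := by
  simpa using v.base (.lt_irrefl a)

theorem congr_arg (f : Tm Γ (σ ⇒ Ty.nat)) {s t : Tm Γ σ} (h : v.holds (Fm.eqAt σ s t)) :
    v.holds (Fm.eq (f ⬝ s) (f ⬝ t)) :=
  (v.imp _ _).1 (v.base (.ext σ Ty.nat s t f)) h

theorem suc_zero : v.holds (Fm.eq (suc zero) one) :=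
  v.eq_trans (v.base (.add_comm _ _)) (v.base (.add_zero _))

theorem zero_lt_one : v.holds (Fm.lt zero one) := by
  have h := v.base (.lt_suc (Γ := Γ) zero zero)
  have h₀ : v.holds (Fm.eq (zero (Γ := Γ)) zero) := v.base (.eq_refl _)
  simp only [Val.iff, Val.le, h₀, or_true, iff_true] at h
  exact (v.lt_congr h₀ v.suc_zero).1 h

theorem zero_ne_one : ¬ v.holds (Fm.eq zero one) := fun h =>
  v.lt_irrefl one ((v.lt_congr h (v.base (.eq_refl _))).1 v.zero_lt_one)

/-- Discreteness: `a < 0 + 1` gives `a ≤ 0`, and `0` is least. -/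
theorem eq_zero_or_one {a : Tm Γ Ty.nat} (h : v.holds (Fm.le a one)) :
    v.holds (Fm.eq a zero) ∨ v.holds (Fm.eq a one) := by
  rw [v.le] at h
  refine h.imp (fun h => ?_) id
  have h₁ := (v.lt_congr (v.base (.eq_refl _)) (v.eq_symm v.suc_zero)).1 h
  have h₂ := v.base (.lt_suc a zero)
  have h₃ := v.base (.zero_le a)
  have h₄ := v.base (.lt_trans a zero a)
  simp only [Val.iff, Val.le, h₁, true_iff] at h₂
  simp only [Val.imp, v.lt_irrefl] at h₄
  rw [v.le] at h₃
  rcases h₂ with h₂ | h₂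
  · rcases h₃ with h₃ | h₃
    · exact (h₄ h₂ h₃).elim
    · exact v.eq_symm h₃
  · exact h₂

end Val

/-! ### Definition by cases -/

/-- The sequence `a, b, b, b, …`. -/
def Tm.branch (a b : Tm Γ Ty.nat) : Tm Γ (Ty.pure 1) :=
  R Ty.nat ⬝ (K _ _ ⬝ (K _ _ ⬝ b)) ⬝ a

-- Unlike `ifz`, the case distinction `branch` is written without `lam`, so arbitrary substitutions
-- commute with it.
@[simp] theorem Tm.branch_subst {Ξ : List Ty} (θ : Sub Γ Ξ) (a b : Tm Γ Ty.nat) :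
    (branch a b).subst θ = branch (a.subst θ) (b.subst θ) := rfl

namespace Val

variable (v : Val Z2Omega Δ)

theorem branch_zero (a b : Tm Γ Ty.nat) : v.holds (Fm.eq (branch a b ⬝ zero) a) :=
  v.base (.R_zero _ _)

theorem branch_one (a b : Tm Γ Ty.nat) : v.holds (Fm.eq (branch a b ⬝ one) b) := by
  refine v.eq_trans (v.congr_arg (σ := Ty.nat) _ (v.eq_symm v.suc_zero)) ?_
  refine v.eq_trans (v.base (.R_suc _ _ _)) (v.thm _ ?_)
  exact (Proves.eqAt_app (Proves.eqAt_K (σ := Ty.nat ⇒ Ty.nat) _ _) _).eqAt_trans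
    (Proves.eqAt_K (σ := Ty.nat) _ _)

theorem branch_of_eq_zero {c : Tm Γ Ty.nat} (h : v.holds (Fm.eq c zero)) (a b : Tm Γ Ty.nat) :
    v.holds (Fm.eq (branch a b ⬝ c) a) :=
  v.eq_trans (v.congr_arg (σ := Ty.nat) _ h) (v.branch_zero a b)

theorem branch_of_eq_one {c : Tm Γ Ty.nat} (h : v.holds (Fm.eq c one)) (a b : Tm Γ Ty.nat) :
    v.holds (Fm.eq (branch a b ⬝ c) b) :=
  v.eq_trans (v.congr_arg (σ := Ty.nat) _ h) (v.branch_one a b)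

end Val

end Equality


/-! ### Deciding second-order formulas by `∃³` -/

/-- All quantifiers range over the types `0` and `1`. -/
def Fm.SecondOrder : {Γ : List Ty} → Fm Γ → Prop
  | _, eq _ _ => True
  | _, lt _ _ => True
  | _, bot => True
  | _, imp φ ψ => SecondOrder φ ∧ SecondOrder ψ
  | _, all Ty.nat φ => SecondOrder φ
  | _, all (Ty.nat ⇒ Ty.nat) φ => SecondOrder φ
  | _, all _ _ => False

namespace Tm

/-- A term that equals `0` if the second-order formula `φ` holds, and `1` otherwise, provided that
`E` is the functional `∃³` and that `D f = 0` if and only if `f 0 < f 1`. -/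
def dec : {Γ : List Ty} → Tm Γ (Ty.pure 3) → Tm Γ (Ty.pure 2) → Fm Γ → Tm Γ Ty.nat
  | _, _, D, Fm.eq s t => branch one (branch one zero ⬝ (D ⬝ branch t s)) ⬝ (D ⬝ branch s t)
  | _, _, D, Fm.lt s t => D ⬝ branch s t
  | _, _, _, Fm.bot => one
  | _, E, D, Fm.imp φ ψ => branch (dec E D ψ) zero ⬝ dec E D φ
  | Γ, E, D, Fm.all Ty.nat φ =>
    branch one zero ⬝ (E ⬝ lam (branch one zero ⬝
      (dec E.wk D.wk φ).subst (Sub.cons (v0 ⬝ zero) (Sub.shift Γ (Ty.pure 1)))))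
  | _, E, D, Fm.all (Ty.nat ⇒ Ty.nat) φ =>
    branch one zero ⬝ (E ⬝ lam (branch one zero ⬝ dec E.wk D.wk φ))
  | _, _, _, Fm.all _ _ => zero

end Tm

section Derivability

open Tm

variable {Γ : List Ty} {Δ : List (Fm Γ)}

namespace Fm

/-- `c` is the truth value of `φ`. -/
def truthValue (φ : Fm Γ) (c : Tm Γ Ty.nat) : Fm Γ :=
  and (imp φ (eq c zero)) (imp (neg φ) (eq c one))

@[simp] theorem truthValue_subst {Ξ : List Ty} (θ : Sub Γ Ξ) (φ : Fm Γ) (c : Tm Γ Ty.nat) :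
    (truthValue φ c).subst θ = truthValue (φ.subst θ) (c.subst θ) := rfl

/-- The matrix of `(∃³)`. -/
def isExists3 (E : Tm Γ (Ty.pure 3)) : Fm Γ :=
  and (all (Ty.pure 2) (le (E.wk ⬝ v0) one))
    (all (Ty.pure 2) (iff (ex (Ty.pure 1) (eq (v1 ⬝ v0) zero)) (eq (E.wk ⬝ v0) zero)))

/-- `D f` is the truth value of `f 0 < f 1`. -/
def isLtDec (D : Tm Γ (Ty.pure 2)) : Fm Γ :=
  all (Ty.pure 1) (truthValue (lt (v0 ⬝ zero) (v0 ⬝ one)) (D.wk ⬝ v0))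

theorem isExists3_wk {σ : Ty} (E : Tm Γ (Ty.pure 3)) :
    (isExists3 E).wk (σ := σ) = isExists3 E.wk := by
  simp [isExists3, wk, v1_eq_wk]; rfl

theorem isLtDec_wk {σ : Ty} (D : Tm Γ (Ty.pure 2)) :
    (isLtDec D).wk (σ := σ) = isLtDec D.wk := by
  simp [isLtDec, wk]; rfl

end Fm

/-- `(λx. s) x = s`. -/
theorem Proves.beta_v0 {ρ σ : Ty} {Δ : List (Fm (ρ :: Γ))} (s : Tm (ρ :: Γ) σ) :
    Proves Z2Omega Δ (Fm.eqAt σ ((lam s).wk ⬝ v0) s) := by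
  have := beta (Δ := Δ) (s.subst (Sub.lift (Sub.shift Γ ρ))) (v0 (σ := ρ))
  rwa [← lam_subst Sub.isRen_shift, subst_subst, Sub.lift_cons_id, Sub.cons_v0_shift,
    subst_id] at this

namespace Val

variable (v : Val Z2Omega Δ)

theorem truthValue {φ : Fm Γ} {c : Tm Γ Ty.nat} :
    v.holds (Fm.truthValue φ c) ↔
      (v.holds φ ∧ v.holds (Fm.eq c zero)) ∨ (¬ v.holds φ ∧ v.holds (Fm.eq c one)) := by
  by_cases h : v.holds φ <;> simp [Fm.truthValue, h]

theorem not_eq_zero_of_eq_one {c : Tm Γ Ty.nat} (h : v.holds (Fm.eq c one)) :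
    ¬ v.holds (Fm.eq c zero) := fun h' => v.zero_ne_one (v.eq_trans (v.eq_symm h') h)

theorem iff_of_truthValue {φ : Fm Γ} {c : Tm Γ Ty.nat} (h : v.holds (Fm.truthValue φ c)) :
    v.holds φ ↔ v.holds (Fm.eq c zero) := by
  rcases v.truthValue.1 h with h | h
  · simp [h]
  · simp [h, v.not_eq_zero_of_eq_one h.2]

theorem truthValue_congr {φ ψ : Fm Γ} {c d : Tm Γ Ty.nat} (h : v.holds (Fm.truthValue φ c))
    (hφ : v.holds φ ↔ v.holds ψ) (hc : v.holds (Fm.eq d c)) : v.holds (Fm.truthValue ψ d) := by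
  rw [truthValue] at h ⊢
  rwa [v.eq_congr_left hc, v.eq_congr_left hc, ← hφ]

theorem truthValue_neg {φ : Fm Γ} {c : Tm Γ Ty.nat} (h : v.holds (Fm.truthValue φ c)) :
    v.holds (Fm.truthValue (Fm.neg φ) (branch one zero ⬝ c)) := by
  rw [truthValue] at h ⊢
  rcases h with ⟨h₁, h₂⟩ | ⟨h₁, h₂⟩
  · exact .inr ⟨by simp [h₁], v.branch_of_eq_zero h₂ _ _⟩
  · exact .inl ⟨by simp [h₁], v.branch_of_eq_one h₂ _ _⟩

theorem truthValue_of_eq_zero_or_one {c : Tm Γ Ty.nat}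
    (h : v.holds (Fm.eq c zero) ∨ v.holds (Fm.eq c one)) :
    v.holds (Fm.truthValue (Fm.eq c zero) c) := by
  rw [truthValue]
  rcases h with h | h
  · exact .inl ⟨h, h⟩
  · exact .inr ⟨v.not_eq_zero_of_eq_one h, h⟩

/-- The property of `D` is instantiated at the sequence `s, t, t, …`. -/
theorem lt_truthValue {D : Tm Γ (Ty.pure 2)} (hD : Fm.isLtDec D ∈ Δ) (s t : Tm Γ Ty.nat) :
    v.holds (Fm.truthValue (Fm.lt s t) (D ⬝ branch s t)) := by
  have h := v.inst (σ := Ty.pure 1) (v.hyp hD) (branch s t)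
  simp only [Fm.inst, Fm.truthValue_subst, Fm.lt_subst, app_subst, v0_subst_cons, zero_subst,
    one_subst, wk_subst_cons, subst_id] at h
  exact v.truthValue_congr h (v.lt_congr (v.branch_zero _ _) (v.branch_one _ _))
    (v.base (.eq_refl _))

/-- The application of `∃³` to a characteristic function decides a universal quantification over
the objects of type `1`. -/
theorem all_truthValue {E : Tm Γ (Ty.pure 3)} (hE : Fm.isExists3 E ∈ Δ)
    {φ : Fm (Ty.pure 1 :: Γ)} {c : Tm (Ty.pure 1 :: Γ) Ty.nat}
    (h : v.holds (Fm.all (Ty.pure 1) (Fm.truthValue φ c))) :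
    v.holds (Fm.truthValue (Fm.all (Ty.pure 1) φ)
      (branch one zero ⬝ (E ⬝ lam (branch one zero ⬝ c)))) := by
  -- `branch one zero` negates truth values. Thus `Y` vanishes exactly at the counterexamples to
  -- `φ`, `E ⬝ Y` says whether there is one, and the outer negation gives the value of the universal
  -- formula.
  set Y : Tm Γ (Ty.pure 2) := lam (branch one zero ⬝ c) with hY
  have hE' := v.hyp hE
  rw [Fm.isExists3, Val.and] at hE'
  have hE₁ := v.inst hE'.1 Y
  have hE₂ := v.inst hE'.2 Y
  simp only [Fm.inst, Fm.le_subst, Fm.iff_subst, Fm.ex_subst, Fm.eq_subst, app_subst,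
    v0_subst_cons, zero_subst, one_subst, wk_subst_cons, subst_id, v1_subst_lift,
    v0_subst_lift, Val.iff] at hE₁ hE₂
  have key : v.holds (Fm.all (Ty.pure 1) (Fm.neg (Fm.eq (Y.wk ⬝ v0) zero))) ↔
      v.holds (Fm.all (Ty.pure 1) φ) := by
    refine v.all_congr (v.all_mp (v.thm _ (.allI (.of_val fun w => ?_))) h)
    rw [Val.imp]
    intro hw
    have hβ : w.holds (Fm.eq (Y.wk ⬝ v0) (branch one zero ⬝ c)) :=
      w.thm _ (.beta_v0 (σ := Ty.nat) _)
    have h₁ := w.iff_of_truthValue (w.truthValue_neg hw)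
    rw [Val.iff, Val.neg, w.eq_congr_left hβ, ← h₁]
    simp
  have h₂ := v.truthValue_neg (v.truthValue_of_eq_zero_or_one (v.eq_zero_or_one hE₁))
  refine v.truthValue_congr h₂ ?_ (v.base (.eq_refl _))
  rw [Val.neg, ← hE₂, v.ex, not_not, key]

/-- A universal quantification over numbers, as one over objects of type `1`. -/
theorem all_nat_truthValue {E : Tm Γ (Ty.pure 3)} (hE : Fm.isExists3 E ∈ Δ)
    {φ : Fm (Ty.nat :: Γ)} {c : Tm (Ty.nat :: Γ) Ty.nat}
    (h : v.holds (Fm.all Ty.nat (Fm.truthValue φ c))) :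
    v.holds (Fm.truthValue (Fm.all Ty.nat φ)
      (branch one zero ⬝ (E ⬝ lam (branch one zero ⬝
        c.subst (Sub.cons (v0 ⬝ zero) (Sub.shift Γ (Ty.pure 1))))))) := by
  set θ : Sub (Ty.nat :: Γ) (Ty.pure 1 :: Γ) :=
    Sub.cons (v0 ⬝ zero) (Sub.shift Γ (Ty.pure 1))
  have h' : v.holds (Fm.all (Ty.pure 1) (Fm.truthValue (φ.subst θ) (c.subst θ))) :=
    v.all_comp (τ := Ty.pure 1) _ h
  -- Passing from the formulas to the equations `d = 0` means that replacing equals by equals is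
  -- needed only inside terms, where `eqAt_subst_congr` does it, and not inside formulas.
  have hiff : ∀ {σ : Ty} {ψ : Fm (σ :: Γ)} {d : Tm (σ :: Γ) Ty.nat},
      v.holds (Fm.all σ (Fm.truthValue ψ d)) →
        (v.holds (Fm.all σ ψ) ↔ v.holds (Fm.all σ (Fm.eq d zero))) := by
    intro σ ψ d hd
    refine v.all_congr (v.all_mp (v.thm _ (.allI (.of_val fun w => ?_))) hd)
    rw [Val.imp, Val.iff]
    exact w.iff_of_truthValue
  refine v.truthValue_congr (v.all_truthValue hE h') ?_ (v.base (.eq_refl _))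
  refine ⟨fun h₁ => ?_, fun h₁ => v.all_comp (τ := Ty.pure 1) _ h₁⟩
  rw [hiff h'] at h₁
  rw [hiff h]
  -- Every number `n` is the value at `0` of the constant sequence `K n`.
  have h₂ := v.all_comp (K Ty.nat Ty.nat ⬝ v0) h₁
  refine v.all_mp (v.thm _ (.allI (.of_val fun w => ?_))) h₂
  rw [Val.imp]
  refine w.eq_trans (w.eq_symm (w.thm _ ?_))
  have := Proves.eqAt_subst_congr (Δ := Δ.map Fm.wk) c
    (θ := fun τ v => (θ τ v).subst (Sub.cons (K Ty.nat Ty.nat ⬝ v0) (Sub.shift Γ Ty.nat)))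
    (θ' := Sub.id _) ?_
  · rw [subst_id] at this
    rw [subst_subst]
    exact this
  · intro τ u
    cases u with
    | zero => exact Proves.eqAt_K (σ := Ty.nat) _ _
    | succ u => exact Proves.eqAt_refl _

end Val

/-- Induction on `φ` in all contexts at once: under a quantifier the assumptions on `E` and `D` are
weakened, and generalization yields the truth values of all instances uniformly. -/
theorem Proves.dec {E : Tm Γ (Ty.pure 3)} {D : Tm Γ (Ty.pure 2)} (hE : Fm.isExists3 E ∈ Δ)
    (hD : Fm.isLtDec D ∈ Δ) (φ : Fm Γ) (hφ : φ.SecondOrder) :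
    Proves Z2Omega Δ (Fm.truthValue φ (dec E D φ)) := by
  induction φ with
  | eq s t =>
    refine .of_val fun v => ?_
    have h₁ := v.lt_truthValue hD s t
    have h₂ := v.lt_truthValue hD t s
    have h₃ := v.base (.lt_total s t)
    rw [Val.truthValue] at h₁ h₂ ⊢
    rw [Val.or, Val.or] at h₃
    rw [Tm.dec]
    have h₀ : v.holds (Fm.lt s t) ∨ v.holds (Fm.lt t s) → ¬ v.holds (Fm.eq s t) := by
      intro h h'
      rcases h with h | h
      · exact v.lt_irrefl _ ((v.lt_congr h' (v.base (.eq_refl _))).1 h)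
      · exact v.lt_irrefl _ ((v.lt_congr (v.base (.eq_refl _)) h').1 h)
    -- By trichotomy, equality is the failure of both `s < t` and `t < s`; `dec` tests these in
    -- turn.
    rcases h₁ with ⟨h₁, h₁'⟩ | ⟨h₁, h₁'⟩
    · exact .inr ⟨h₀ (.inl h₁), v.branch_of_eq_zero h₁' _ _⟩
    · rcases h₂ with ⟨h₂, h₂'⟩ | ⟨h₂, h₂'⟩
      · exact .inr ⟨h₀ (.inr h₂),
          v.eq_trans (v.branch_of_eq_one h₁' _ _) (v.branch_of_eq_zero h₂' _ _)⟩
      · exact .inl ⟨by tauto,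
          v.eq_trans (v.branch_of_eq_one h₁' _ _) (v.branch_of_eq_one h₂' _ _)⟩
  | lt s t => exact .of_val fun v => v.lt_truthValue hD s t
  | bot =>
    refine .of_val fun v => v.truthValue.2 (.inr ⟨v.bot, v.base (.eq_refl _)⟩)
  | imp φ ψ ih₁ ih₂ =>
    refine .of_val fun v => ?_
    have h₁ := v.thm _ (ih₁ hE hD hφ.1)
    have h₂ := v.thm _ (ih₂ hE hD hφ.2)
    rw [Val.truthValue] at h₁
    rw [Tm.dec]
    rcases h₁ with ⟨h₁, h₁'⟩ | ⟨h₁, h₁'⟩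
    · exact v.truthValue_congr h₂ (by simp [h₁]) (v.branch_of_eq_zero h₁' _ _)
    · exact v.truthValue.2 (.inl ⟨by simp [h₁], v.branch_of_eq_one h₁' _ _⟩)
  | all σ φ ih =>
    have hE' : Fm.isExists3 (E.wk (τ := σ)) ∈ Δ.map Fm.wk :=
      List.mem_map.2 ⟨_, hE, Fm.isExists3_wk E⟩
    have hD' : Fm.isLtDec (D.wk (τ := σ)) ∈ Δ.map Fm.wk :=
      List.mem_map.2 ⟨_, hD, Fm.isLtDec_wk D⟩
    have h : φ.SecondOrder → Proves Z2Omega Δ (Fm.all σ (Fm.truthValue φ (Tm.dec E.wk D.wk φ))) :=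
      fun h => .allI (ih hE' hD' h)
    clear ih hE' hD'
    refine .of_val fun v => ?_
    match σ, φ, hφ, h with
    | Ty.nat, φ, hφ, h => exact v.all_nat_truthValue hE (v.thm _ (h hφ))
    | Ty.nat ⇒ Ty.nat, φ, hφ, h => exact v.all_truthValue hE (v.thm _ (h hφ))

/-- `QF-AC^{1,0}` applied to "`y` is the truth value of `f 0 < f 1`" provides `D` without any
verification of truncated subtraction inside the theory. -/
theorem Proves.exists_isLtDec :
    Proves Z2Omega Δ (Fm.ex (Ty.pure 2) (Fm.isLtDec v0)) := by
  let A : Fm (Ty.nat :: Ty.pure 1 :: Γ) :=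
    Fm.truthValue (Fm.lt (v1 ⬝ zero) (v1 ⬝ one)) v0
  have hA : A.QF := by simp [A, Fm.QF, Fm.truthValue, Fm.and, Fm.neg]
  refine impE (base (.qf_ac A hA)) (allI (.of_val fun v => ?_))
  by_cases h : v.holds (Fm.lt (v0 ⬝ zero) (v0 ⬝ one))
  · refine v.ex_intro zero ?_
    change v.holds (Fm.truthValue (Fm.lt (v0 ⬝ zero) (v0 ⬝ one)) zero)
    exact v.truthValue.2 (.inl ⟨h, v.base (.eq_refl _)⟩)
  · refine v.ex_intro one ?_
    change v.holds (Fm.truthValue (Fm.lt (v0 ⬝ zero) (v0 ⬝ one)) one)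
    exact v.truthValue.2 (.inr ⟨h, v.base (.eq_refl _)⟩)

/-! ### Second-order comprehension and the principle `open` -/

/-- The object `Y`, of type `1 ⇒ 1`, is not quantified: the quantifiers concern points, of type `1`,
and indices of approximations, of type `0`. -/
theorem Fm.secondOrder_ballSubset (z : Tm Γ (Ty.pure 1)) (r : Tm Γ Ty.nat)
    (Y : Tm Γ (Ty.pure 1 ⇒ Ty.pure 1)) : (Fm.ballSubset z r Y).SecondOrder := by
  simp [Fm.SecondOrder, Fm.ballSubset, Fm.inBall, Fm.mem, Fm.rlt, Fm.and, Fm.neg, Fm.ex, Fm.qlt]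

theorem Fm.SecondOrder.subst {φ : Fm Γ} (h : φ.SecondOrder) {Ξ : List Ty} (θ : Sub Γ Ξ) :
    (φ.subst θ).SecondOrder := by
  induction φ generalizing Ξ with
  | imp φ ψ h₁ h₂ => exact ⟨h₁ h.1 θ, h₂ h.2 θ⟩
  | all σ φ ih =>
    match σ, φ, h, ih with
    | Ty.nat, φ, h, ih => exact ih h _
    | Ty.nat ⇒ Ty.nat, φ, h, ih => exact ih h _
  | _ => trivial

/-- There is a set of numbers whose elements are those that satisfy `φ`. -/
def Fm.compr (φ : Fm (Ty.nat :: Γ)) : Fm Γ :=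
  ex (Ty.pure 1) (and (all Ty.nat (le (v1 ⬝ v0) one))
    (all Ty.nat (iff (eq (v1 ⬝ v0) one) (φ.subst (Sub.lift (Sub.shift Γ (Ty.pure 1)))))))

theorem Fm.compr_subst {Ξ : List Ty} (φ : Fm (Ty.nat :: Γ)) (θ : Sub Γ Ξ) :
    (compr φ).subst θ = compr (φ.subst θ.lift) := by
  simp only [compr, ex_subst, and_subst, all_subst, le_subst, iff_subst, eq_subst, app_subst,
    v1_subst_lift, v0_subst_lift, one_subst, subst_subst, Sub.lift_comp]
  rfl

/-- Comprehension for second-order formulas, given `∃³`. -/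
theorem Proves.compr_of_mem {E : Tm Γ (Ty.pure 3)} {D : Tm Γ (Ty.pure 2)}
    (hE : Fm.isExists3 E ∈ Δ) (hD : Fm.isLtDec D ∈ Δ) (φ : Fm (Ty.nat :: Γ))
    (hφ : φ.SecondOrder) : Proves Z2Omega Δ (Fm.compr φ) := by
  -- Truth is coded by `0` but membership by `1`, so the characteristic function is the truth value
  -- of `¬φ`.
  set c : Tm (Ty.nat :: Γ) Ty.nat := branch one zero ⬝ Tm.dec E.wk D.wk φ with hc
  have hX : ∀ w : Val Z2Omega (Δ.map (Fm.wk (σ := Ty.nat))),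
      w.holds (Fm.truthValue (Fm.neg φ) ((lam c).wk ⬝ v0)) := by
    intro w
    have h := w.thm _ (dec (List.mem_map.2 ⟨_, hE, Fm.isExists3_wk E⟩)
      (List.mem_map.2 ⟨_, hD, Fm.isLtDec_wk D⟩) φ hφ)
    exact w.truthValue_congr (w.truthValue_neg h) Iff.rfl (w.thm _ (beta_v0 (σ := Ty.nat) _))
  refine .of_val fun v => v.ex_intro (lam c) ?_
  simp only [Fm.inst, Fm.and_subst, Fm.all_subst, Fm.le_subst, Fm.iff_subst, Fm.eq_subst,
    app_subst, v1_subst_lift, v0_subst_lift, v0_subst_cons, one_subst, Fm.subst_subst,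
    Sub.lift_comp, Val.and]
  refine ⟨v.thm _ (.allI (.of_val fun w => ?_)), v.thm _ (.allI (.of_val fun w => ?_))⟩
  · rcases w.truthValue.1 (hX w) with ⟨-, h⟩ | ⟨-, h⟩
    · rw [Val.le, w.lt_congr h (w.base (.eq_refl _))]
      exact .inl w.zero_lt_one
    · exact (w.le _ _).2 (.inr h)
  · have hid : φ.subst (Sub.lift fun τ u => (Sub.shift Γ (Ty.pure 1) τ u).subst
        (Sub.cons (lam c) (Sub.id Γ))) = φ := by
      rw [show (fun τ u => (Sub.shift Γ (Ty.pure 1) τ u).subst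
        (Sub.cons (lam c) (Sub.id Γ))) = Sub.id Γ from rfl, Sub.lift_id, Fm.subst_id]
    rw [hid, Val.iff]
    rcases w.truthValue.1 (hX w) with ⟨h₁, h⟩ | ⟨h₁, h⟩
    · rw [Val.neg] at h₁
      simp only [h₁, iff_false]
      exact fun h' => w.not_eq_zero_of_eq_one h' h
    · rw [Val.neg, not_not] at h₁
      simp only [h₁, h]

/-- Comprehension for second-order formulas. -/
theorem Proves.compr (φ : Fm (Ty.nat :: Γ)) (hφ : φ.SecondOrder) :
    Proves Z2Omega Δ (Fm.compr φ) := by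
  have h₃ : Proves Z2Omega Δ (Fm.ex (Ty.pure 3) (Fm.isExists3 v0)) := ax (.inr rfl)
  -- The functionals `E` and `D` can be fixed as variables, since the conclusion mentions neither.
  refine exE h₃ (exE exists_isLtDec ?_)
  rw [Fm.wk, Fm.wk, Fm.compr_subst, Fm.compr_subst]
  refine compr_of_mem (E := v0.wk) (D := v0) ?_ (by simp) _ ((hφ.subst _).subst _)
  rw [← Fm.isExists3_wk]
  simp

theorem Proves.openPrinciple : Proves Z2Omega [] Fm.openPrinciple := by
  refine allI (impI ?_)
  have h := compr (Δ := [Fm.isOpenSet v0])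
    (Fm.ballSubset (ratReal (ballCentre v0)) (ballRadius v0)
      (v0 (σ := Ty.pure 1 ⇒ Ty.pure 1) (Γ := [])).wk) (Fm.secondOrder_ballSubset _ _ _)
  -- Comprehension carries a weakening past the variable for the set; pushed down to `Y`, it turns
  -- the instance into the conclusion of `open`.
  rw [Fm.compr, Fm.ballSubset_subst Sub.isRen_shift.lift, ratReal_subst,
    ballCentre_subst Sub.isRen_shift.lift, ballRadius_subst Sub.isRen_shift.lift] at h
  exact h

end Derivability


section

/-! ### Semantics in the full type structure -/

variable {Γ Δ : List Ty} {σ τ ρ : Ty}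

/-- Assignments of values to the variables of a context. -/
abbrev Env (Γ : List Ty) : Type := ∀ τ : Ty, Var Γ τ → τ.Interp

/-- Extend an assignment by a value for the most recent variable. -/
def Env.cons (x : σ.Interp) (e : Env Γ) : Env (σ :: Γ)
  | _, Var.zero => x
  | _, Var.succ v => e _ v

/-- The assignment of the empty context. -/
def Env.nil : Env [] := fun _ v => nomatch v

/-- The value of a term under an assignment. -/
def Tm.evalIn (e : Env Γ) : {σ : Ty} → Tm Γ σ → σ.Interp
  | _, var v => e _ v
  | _, app s t => (evalIn e s) (evalIn e t)
  | _, zero => (0 : ℕ)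
  | _, one => (1 : ℕ)
  | _, add => fun a b : ℕ => (a + b : ℕ)
  | _, mul => fun a b : ℕ => (a * b : ℕ)
  | _, K _ _ => fun x _ => x
  | _, S _ _ _ => fun x y z => x z (y z)
  | _, R σ => fun (f : ℕ → σ.Interp → σ.Interp) (m : σ.Interp) (n : ℕ) =>
      Nat.rec (motive := fun _ => σ.Interp) m f n

/-- Truth of a formula in the full type structure. -/
def Fm.Sat : {Γ : List Ty} → Fm Γ → Env Γ → Prop
  | _, eq s t, e => (s.evalIn e : ℕ) = t.evalIn e
  | _, lt s t, e => (s.evalIn e : ℕ) < (t.evalIn e : ℕ)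
  | _, bot, _ => False
  | _, imp φ ψ, e => Sat φ e → Sat ψ e
  | _, all _ φ, e => ∀ x, Sat φ (e.cons x)

namespace Tm

theorem evalIn_closed (t : Tm [] σ) (e : Env []) : t.evalIn e = t.eval := by
  induction t with
  | var v => cases v
  | app s t hs ht => rw [evalIn, eval, hs, ht]
  | _ => rfl

theorem evalIn_subst (θ : Sub Γ Δ) (e : Env Δ) (t : Tm Γ σ) :
    (t.subst θ).evalIn e = t.evalIn fun τ v => (θ τ v).evalIn e := by
  induction t with
  | app s t hs ht => rw [subst, evalIn, evalIn, hs, ht]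
  | _ => rfl

@[simp] theorem evalIn_wk (x : τ.Interp) (e : Env Γ) (t : Tm Γ σ) :
    t.wk.evalIn (e.cons x) = t.evalIn e := evalIn_subst _ _ _

@[simp] theorem evalIn_lam (e : Env Γ) (t : Tm (ρ :: Γ) σ) :
    (lam t).evalIn e = fun x => t.evalIn (e.cons x) := by
  induction t with
  | var v => cases v <;> rfl
  | app s t hs ht => simp only [lam, evalIn, hs, ht]
  | _ => rfl

/-- The value of a term of type `0`. -/
def val (e : Env Γ) (t : Tm Γ Ty.nat) : ℕ := t.evalIn e

/-- The value of a term of type `1`. -/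
def seq (e : Env Γ) (t : Tm Γ (Ty.pure 1)) : ℕ → ℕ := t.evalIn e

variable (e : Env Γ)

@[simp] theorem val_wk (x : τ.Interp) (t : Tm Γ Ty.nat) : t.wk.val (e.cons x) = t.val e :=
  evalIn_wk _ _ _
@[simp] theorem seq_wk (x : τ.Interp) (t : Tm Γ (Ty.pure 1)) : t.wk.seq (e.cons x) = t.seq e :=
  evalIn_wk _ _ _
@[simp] theorem val_v0 (n : ℕ) : v0.val (e.cons (σ := Ty.nat) n) = n := rfl
@[simp] theorem val_v1 (n : ℕ) (x : τ.Interp) :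
    v1.val ((e.cons (σ := Ty.nat) n).cons x) = n := rfl
@[simp] theorem val_app (f : Tm Γ (Ty.pure 1)) (t : Tm Γ Ty.nat) :
    (f ⬝ t).val e = f.seq e (t.val e) := rfl
@[simp] theorem val_zero : zero.val e = 0 := rfl
@[simp] theorem val_one : one.val e = 1 := rfl
@[simp] theorem val_plus (s t : Tm Γ Ty.nat) : (plus s t).val e = s.val e + t.val e := rfl
@[simp] theorem val_times (s t : Tm Γ Ty.nat) : (times s t).val e = s.val e * t.val e := rfl
@[simp] theorem val_suc (s : Tm Γ Ty.nat) : (suc s).val e = s.val e + 1 := rfl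

theorem val_primrec (a n : Tm Γ Ty.nat) (b : Tm (Ty.nat :: Ty.nat :: Γ) Ty.nat) :
    (primrec a b n).val e = Nat.rec (motive := fun _ => ℕ) (a.val e)
      (fun i r => b.val ((e.cons (σ := Ty.nat) i).cons (σ := Ty.nat) r)) (n.val e) := by
  simp only [primrec, val, evalIn, evalIn_lam]

@[simp] theorem val_pred (n : Tm Γ Ty.nat) : (pred n).val e = n.val e - 1 := by
  rw [pred, val_primrec]
  cases n.val e <;> rfl

@[simp] theorem val_monus (s t : Tm Γ Ty.nat) : (monus s t).val e = s.val e - t.val e := by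
  rw [monus, val_primrec]
  induction t.val e with
  | zero => rfl
  | succ k ih => simp only [val_pred, val_v0] at ih ⊢; rw [ih]; omega

@[simp] theorem seq_branch (a b : Tm Γ Ty.nat) (n : ℕ) :
    (branch a b).seq e n = if n = 0 then a.val e else b.val e := by
  cases n <;> rfl

@[simp] theorem val_ifz (c a b : Tm Γ Ty.nat) :
    (ifz c a b).val e = if c.val e = 0 then a.val e else b.val e := by
  rw [ifz, val_primrec]
  cases c.val e <;> simp

theorem val_ltz_eq_zero (s t : Tm Γ Ty.nat) : (ltz s t).val e = 0 ↔ s.val e < t.val e := by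
  rw [ltz, val_monus, val_suc]; omega

@[simp] theorem val_pow2 (n : Tm Γ Ty.nat) : (pow2 n).val e = 2 ^ n.val e := by
  rw [pow2, val_primrec]
  induction n.val e with
  | zero => rfl
  | succ k ih => simp only [val_plus, val_v0] at ih ⊢; rw [ih]; omega

@[simp] theorem val_isqrt (n : Tm Γ Ty.nat) : (isqrt n).val e = Nat.sqrt (n.val e) := by
  rw [isqrt, val_primrec]
  induction n.val e with
  | zero => rfl
  | succ k ih =>
    simp only [val_ifz, val_ltz_eq_zero, val_suc, val_times, val_v0, val_v1, val_zero] at ih ⊢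
    rw [ih]
    have h₁ := Nat.sqrt_le k
    have h₂ := Nat.lt_succ_sqrt k
    simp only [Nat.succ_eq_add_one] at h₂
    split_ifs with h
    · exact Nat.eq_sqrt.2 ⟨by omega, h⟩
    · exact Nat.eq_sqrt.2 ⟨by omega, by nlinarith⟩

@[simp] theorem val_pair (a b : Tm Γ Ty.nat) :
    (pair a b).val e = Nat.pair (a.val e) (b.val e) := by
  simp [pair, val_ltz_eq_zero, Nat.pair]

@[simp] theorem val_fst (n : Tm Γ Ty.nat) : (fst n).val e = (n.val e).unpair.1 := by
  simp only [fst, excess, val_ifz, val_ltz_eq_zero, val_monus, val_times, val_isqrt, Nat.unpair]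
  split_ifs <;> rfl

@[simp] theorem val_snd (n : Tm Γ Ty.nat) : (snd n).val e = (n.val e).unpair.2 := by
  simp only [snd, excess, val_ifz, val_ltz_eq_zero, val_monus, val_times, val_isqrt, Nat.unpair]
  split_ifs <;> rfl

end Tm

/-! ### The values of the arithmetical terms -/

theorem ratOf_pair (p m d : ℕ) :
    ratOf (Nat.pair (Nat.pair p m) d) = ((p : ℚ) - m) / (d + 1) := by simp [ratOf]

theorem hatIndex_le (f : ℕ → ℕ) (n : ℕ) : hatIndex f n ≤ n := by
  cases n with
  | zero => rfl
  | succ n =>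
    rw [hatIndex]
    split_ifs
    · rfl
    · exact (hatIndex_le f n).trans n.le_succ

namespace Tm

variable (e : Env Γ)

theorem ratOf_qmk (p m d : Tm Γ Ty.nat) (hd : 0 < d.val e) :
    ratOf ((qmk p m d).val e) = ((p.val e : ℚ) - m.val e) / d.val e := by
  rw [qmk, val_pair, val_pair, val_pred, ratOf_pair, Nat.cast_sub hd]
  simp

theorem ratOf_eq (q : Tm Γ Ty.nat) : ratOf (q.val e) =
    (((qpos q).val e : ℚ) - (qneg q).val e) / (qden q).val e := by
  simp [ratOf, qpos, qneg, qden]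

theorem qden_pos (q : Tm Γ Ty.nat) : 0 < (qden q).val e := by
  simp [qden]

theorem ratOf_qzero : ratOf ((qzero (Γ := Γ)).val e) = 0 := by
  rw [qzero, ratOf_qmk _ _ _ _ (by simp)]; simp

theorem ratOf_qhalfpow (n : Tm Γ Ty.nat) : ratOf ((qhalfpow n).val e) = 1 / 2 ^ n.val e := by
  rw [qhalfpow, ratOf_qmk _ _ _ _ (by simp)]; simp

theorem ratOf_qadd (q r : Tm Γ Ty.nat) :
    ratOf ((qadd q r).val e) = ratOf (q.val e) + ratOf (r.val e) := by
  have hq := qden_pos e q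
  have hr := qden_pos e r
  rw [qadd, ratOf_qmk _ _ _ _ (by simpa using ⟨hq, hr⟩), ratOf_eq e q, ratOf_eq e r]
  have hq' : ((qden q).val e : ℚ) ≠ 0 := by exact_mod_cast hq.ne'
  have hr' : ((qden r).val e : ℚ) ≠ 0 := by exact_mod_cast hr.ne'
  simp only [val_plus, val_times]
  push_cast
  field_simp
  ring

theorem ratOf_qsub (q r : Tm Γ Ty.nat) :
    ratOf ((qsub q r).val e) = ratOf (q.val e) - ratOf (r.val e) := by
  rw [qsub, ratOf_qadd, ratOf_qmk _ _ _ _ (qden_pos e r), ratOf_eq e r]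
  ring

theorem val_qltL_lt_qltR (q r : Tm Γ Ty.nat) :
    (qltL q r).val e < (qltR q r).val e ↔ ratOf (q.val e) < ratOf (r.val e) := by
  have hq : (0 : ℚ) < (qden q).val e := by exact_mod_cast qden_pos e q
  have hr : (0 : ℚ) < (qden r).val e := by exact_mod_cast qden_pos e r
  rw [ratOf_eq e q, ratOf_eq e r, div_lt_div_iff₀ hq hr, ← Nat.cast_lt (α := ℚ)]
  simp only [qltL, qltR, val_plus, val_times]
  push_cast
  constructor <;> intro h <;> linarith

theorem val_qltz_eq_zero (q r : Tm Γ Ty.nat) :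
    (qltz q r).val e = 0 ↔ ratOf (q.val e) < ratOf (r.val e) := by
  rw [qltz, val_ltz_eq_zero, val_qltL_lt_qltR]

theorem val_hatIdx (f : Tm Γ (Ty.pure 1)) (n : Tm Γ Ty.nat) :
    (hatIdx f n).val e = hatIndex (f.seq e) (n.val e) := by
  rw [hatIdx, val_primrec]
  induction n.val e with
  | zero => rfl
  | succ k ih =>
    simp only [val_ifz, val_plus, val_monus, val_v0, val_v1, val_suc, val_zero,
      Nat.add_eq_zero_iff, val_qltz_eq_zero, ratOf_qsub, ratOf_qhalfpow, val_app,
      seq_wk] at ih ⊢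
    rw [ih, hatIndex]
    -- Because of this bound, the vanishing of the truncated difference `k - hatIndex` expresses
    -- equality.
    have hk := hatIndex_le (f.seq e) k
    have h : hatIndex (f.seq e) k = k ↔ k - hatIndex (f.seq e) k = 0 := by omega
    have h' : |ratOf (f.seq e k) - ratOf (f.seq e (k + 1))| < 1 / 2 ^ (k + 1) ↔
        ratOf (f.seq e (k + 1)) - ratOf (f.seq e k) < 1 / 2 ^ (k + 1) ∧
          ratOf (f.seq e k) - ratOf (f.seq e (k + 1)) < 1 / 2 ^ (k + 1) := by
      rw [abs_lt, neg_lt, neg_sub]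
    simp only [h', ← h]
    split_ifs with h₁ h₂ h₂
    · rw [h₁.1]
    · exact absurd ⟨h₁.1, h₁.2.2, h₁.2.1⟩ h₂
    · exact absurd ⟨h₂.1, h₂.2.2, h₂.2.1⟩ h₁
    · rfl

theorem val_hat (f : Tm Γ (Ty.pure 1)) (n : Tm Γ Ty.nat) :
    (hat f n).val e = f.seq e (hatIndex (f.seq e) (n.val e)) := by
  rw [hat, val_app, val_hatIdx]

end Tm

/-! ### Codes of reals -/

theorem exists_ratOf (q : ℚ) : ∃ c, ratOf c = q := by
  -- Positive and negative part of the numerator; the code stores the denominator minus one.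
  refine ⟨Nat.pair (Nat.pair q.num.toNat (-q.num).toNat) (q.den - 1), ?_⟩
  have h : ((q.num.toNat : ℕ) : ℚ) - ((-q.num).toNat : ℕ) = q.num := by
    exact_mod_cast Int.toNat_sub_toNat_neg q.num
  rw [ratOf_pair, h, Nat.cast_sub q.pos]
  simpa using q.num_div_den

theorem dist_hat_succ_lt (f : ℕ → ℕ) (n : ℕ) :
    |ratOf (f (hatIndex f n)) - ratOf (f (hatIndex f (n + 1)))| < 1 / 2 ^ (n + 1) := by
  rw [hatIndex]
  split_ifs with h
  · rw [h.1]; exact h.2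
  · simp

theorem dist_hat_succ_le (f : ℕ → ℕ) (n : ℕ) :
    dist ((ratOf (f (hatIndex f n)) : ℚ) : ℝ) (ratOf (f (hatIndex f (n + 1))) : ℚ)
      ≤ 1 / 2 / 2 ^ n := by
  have h := (Rat.cast_lt (K := ℝ)).2 (dist_hat_succ_lt f n)
  push_cast at h
  rw [Real.dist_eq, div_div, ← pow_succ']
  exact h.le

theorem exists_codesReal (f : ℕ → ℕ) : ∃ x, CodesReal f x :=
  cauchySeq_tendsto_of_complete (cauchySeq_of_le_geometric_two (dist_hat_succ_le f))

theorem CodesReal.abs_sub_le {f : ℕ → ℕ} {x : ℝ} (h : CodesReal f x) (n : ℕ) :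
    |((ratOf (f (hatIndex f n)) : ℚ) : ℝ) - x| ≤ 1 / 2 ^ n :=
  dist_le_of_le_geometric_two_of_tendsto (dist_hat_succ_le f) h n

theorem hatIndex_eq_self {f : ℕ → ℕ}
    (h : ∀ n, |ratOf (f n) - ratOf (f (n + 1))| < 1 / 2 ^ (n + 1)) (n : ℕ) :
    hatIndex f n = n := by
  induction n with
  | zero => rfl
  | succ n ih => rw [hatIndex, if_pos ⟨ih, h n⟩]

/-- The `n`-th approximations are within `2 ^ (-n)` of their limits, so a gap larger than twice this
error survives in the limit. -/
theorem CodesReal.lt_iff {f g : ℕ → ℕ} {x y : ℝ} (hf : CodesReal f x) (hg : CodesReal g y) :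
    (∃ n : ℕ, ratOf (f (hatIndex f n)) + (1 / 2 ^ n + 1 / 2 ^ n) < ratOf (g (hatIndex g n))) ↔
      x < y := by
  constructor
  · rintro ⟨n, hn⟩
    have h₁ := abs_le.1 (hf.abs_sub_le n)
    have h₂ := abs_le.1 (hg.abs_sub_le n)
    have h₃ := (Rat.cast_lt (K := ℝ)).2 hn
    push_cast at h₃
    linarith
  · intro h
    -- A quarter, since `y - x` has to absorb two errors of approximation and a required gap of two
    -- more.
    obtain ⟨n, hn⟩ := exists_pow_lt_of_lt_one (show 0 < (y - x) / 4 by linarith)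
      (show (1 / 2 : ℝ) < 1 by norm_num)
    rw [div_pow, one_pow] at hn
    refine ⟨n, ?_⟩
    have h₁ := abs_le.1 (hf.abs_sub_le n)
    have h₂ := abs_le.1 (hg.abs_sub_le n)
    rw [← Rat.cast_lt (K := ℝ)]
    push_cast
    linarith

theorem codesReal_const (c : ℕ) : CodesReal (fun _ => c) (ratOf c) := tendsto_const_nhds

/-- A shift preserves consecutive differences, so `g` converges as fast as the hat of `f` and is its
own hat. -/
theorem CodesReal.add_rat {f g : ℕ → ℕ} {x : ℝ} (hf : CodesReal f x) {q : ℚ}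
    (h : ∀ n, ratOf (g n) = ratOf (f (hatIndex f n)) + q) : CodesReal g (x + q) := by
  have hg : ∀ n, hatIndex g n = n := hatIndex_eq_self fun n => by
    rw [h, h, add_sub_add_right_eq_sub]
    exact dist_hat_succ_lt f n
  simp only [CodesReal, hg, h, Rat.cast_add]
  exact hf.add_const _

theorem exists_code (x : ℝ) : ∃ f, CodesReal f x := by
  -- With this precision two consecutive errors add up to less than `1 / 2 ^ (n + 1)`, and the hat
  -- never intervenes.
  have h : ∀ n : ℕ, ∃ c : ℕ, |((ratOf c : ℚ) : ℝ) - x| < 1 / 2 ^ (n + 2) := by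
    intro n
    obtain ⟨q, h₁, h₂⟩ := exists_rat_btwn (show x < x + 1 / 2 ^ (n + 2) by simp)
    obtain ⟨c, rfl⟩ := exists_ratOf q
    exact ⟨c, abs_lt.2 ⟨by linarith, by linarith⟩⟩
  choose f hf using h
  refine ⟨f, ?_⟩
  have hidx : ∀ n, hatIndex f n = n := hatIndex_eq_self fun n => by
    have h₁ := abs_lt.1 (hf n)
    have h₂ := abs_lt.1 (hf (n + 1))
    have h₃ : (1 : ℝ) / 2 ^ (n + 1) = 1 / 2 ^ (n + 2) + 1 / 2 ^ (n + 2) := by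
      field_simp; ring
    have h₄ : (1 : ℝ) / 2 ^ (n + 1 + 2) ≤ 1 / 2 ^ (n + 2) :=
      one_div_pow_le_one_div_pow_of_le one_le_two (by omega)
    rw [← Rat.cast_lt (K := ℝ)]
    push_cast
    exact abs_lt.2 ⟨by linarith, by linarith⟩
  simp only [CodesReal, hidx]
  refine tendsto_iff_dist_tendsto_zero.2 (squeeze_zero (fun _ => dist_nonneg)
    (fun n => (hf n).le) ?_)
  have := (tendsto_pow_atTop_nhds_zero_of_lt_one (r := (1 / 2 : ℝ)) (by norm_num)
    (by norm_num)).comp (Filter.tendsto_add_atTop_nat 2)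
  simpa [Function.comp_def] using this

/-! ### Truth of the formulas about reals -/

namespace Fm

open Tm

variable (e : Env Γ)

@[simp] theorem sat_neg (φ : Fm Γ) : (neg φ).Sat e ↔ ¬ φ.Sat e := Iff.rfl
@[simp] theorem sat_and (φ ψ : Fm Γ) : (and φ ψ).Sat e ↔ φ.Sat e ∧ ψ.Sat e := by
  simp [and, Sat]
@[simp] theorem sat_ex (φ : Fm (σ :: Γ)) : (ex σ φ).Sat e ↔ ∃ x, φ.Sat (e.cons x) := by
  simp [ex, Sat]

theorem sat_eq (s t : Tm Γ Ty.nat) : (eq s t).Sat e ↔ s.val e = t.val e := Iff.rfl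
theorem sat_lt (s t : Tm Γ Ty.nat) : (lt s t).Sat e ↔ s.val e < t.val e := Iff.rfl

theorem sat_imp (φ ψ : Fm Γ) : (imp φ ψ).Sat e ↔ (φ.Sat e → ψ.Sat e) := Iff.rfl

theorem sat_rlt {s t : Tm Γ (Ty.pure 1)} {x y : ℝ} (hs : CodesReal (s.seq e) x)
    (ht : CodesReal (t.seq e) y) : (rlt s t).Sat e ↔ x < y := by
  rw [← hs.lt_iff ht, rlt, sat_ex]
  refine exists_congr fun n => ?_
  rw [qlt, sat_lt, val_qltL_lt_qltR, ratOf_qadd, ratOf_qadd, ratOf_qhalfpow, val_hat, val_hat,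
    val_v0, seq_wk, seq_wk]

theorem codesReal_ratReal (q : Tm Γ Ty.nat) :
    CodesReal ((ratReal q).seq e) (ratOf (q.val e)) := codesReal_const _

theorem codesReal_addRat {s : Tm Γ (Ty.pure 1)} {x : ℝ} (hs : CodesReal (s.seq e) x)
    (q : Tm Γ Ty.nat) : CodesReal ((addRat s q).seq e) (x + (ratOf (q.val e) : ℚ)) := by
  refine hs.add_rat fun n => ?_
  have h : (addRat s q).seq e n =
      (qadd (hat s.wk v0) q.wk).val (e.cons (σ := Ty.nat) n) :=
    congrFun (evalIn_lam (σ := Ty.nat) (ρ := Ty.nat) e _) n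
  rw [h, ratOf_qadd, val_hat, val_wk, seq_wk, val_v0]

theorem sat_inBall {s z : Tm Γ (Ty.pure 1)} {x c : ℝ} (hs : CodesReal (s.seq e) x)
    (hz : CodesReal (z.seq e) c) (r : Tm Γ Ty.nat) :
    (inBall s z r).Sat e ↔ x ∈ Metric.ball c (ratOf (r.val e) : ℚ) := by
  rw [inBall, sat_and, sat_rlt e hs (codesReal_addRat e hz r),
    sat_rlt e hz (codesReal_addRat e hs r), Metric.mem_ball, Real.dist_eq, abs_lt]
  constructor <;> rintro ⟨h₁, h₂⟩ <;> constructor <;> linarith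

/-- A quantifier over type `1` amounts to one over `ℝ`: each sequence codes a real, each real has a
code, and by `CodesFun` the choice of code is irrelevant. -/
theorem sat_ballSubset {z : Tm Γ (Ty.pure 1)} {c : ℝ} (hz : CodesReal (z.seq e) c)
    (r : Tm Γ Ty.nat) {Y : Tm Γ (Ty.pure 1 ⇒ Ty.pure 1)} {F : ℝ → ℝ}
    (hY : CodesFun (Y.evalIn e) F) :
    (ballSubset z r Y).Sat e ↔ Metric.ball c (ratOf (r.val e) : ℚ) ⊆ {x | 0 < F x} := by
  have key : ∀ (f : ℕ → ℕ) (x : ℝ), CodesReal f x →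
      ((imp (inBall v0 z.wk r.wk) (mem v0 Y.wk)).Sat (e.cons (σ := Ty.pure 1) f) ↔
        (x ∈ Metric.ball c (ratOf (r.val e) : ℚ) → 0 < F x)) := by
    intro f x hf
    have h₀ := codesReal_ratReal (e.cons (σ := Ty.pure 1) f) qzero
    rw [ratOf_qzero, Rat.cast_zero] at h₀
    have hYf : (Y.wk ⬝ v0).seq (e.cons (σ := Ty.pure 1) f) = Y.evalIn e f := by
      rw [seq, evalIn, evalIn_wk]; rfl
    have hYfx : CodesReal ((Y.wk ⬝ v0).seq (e.cons (σ := Ty.pure 1) f)) (F x) := by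
      rw [hYf]
      exact hY f x hf
    have hz' : CodesReal (z.wk.seq (e.cons (σ := Ty.pure 1) f)) c := by
      rw [seq_wk]
      exact hz
    have hf' : CodesReal (v0.seq (e.cons (σ := Ty.pure 1) f)) x := hf
    rw [sat_imp, sat_inBall _ hf' hz', val_wk, mem, sat_rlt _ h₀ hYfx]
  constructor
  · intro h x hx
    obtain ⟨f, hf⟩ := exists_code x
    exact (key f x hf).1 (h f) hx
  · intro h f
    obtain ⟨x, hf⟩ := exists_codesReal f
    exact (key f x hf).2 fun hx => h hx

end Fm

/-! ### Decision by `∃³` in the full type structure -/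

theorem exists3_eq_zero (Y : (ℕ → ℕ) → ℕ) : (exists3 Y : ℕ) = 0 ↔ ∃ f, Y f = 0 := by
  rw [exists3]
  split_ifs with h <;> simp [h]

namespace Tm

theorem val_exists3_lam {e : Env Γ} {E : Tm Γ (Ty.pure 3)} (hE : E.evalIn e = exists3)
    (c : Tm (Ty.pure 1 :: Γ) Ty.nat) :
    (branch one zero ⬝ (E ⬝ lam (branch one zero ⬝ c))).val e = 0 ↔
      ∀ f : ℕ → ℕ, c.val (e.cons (σ := Ty.pure 1) f) = 0 := by
  have h : (E ⬝ lam (branch one zero ⬝ c)).val e =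
      exists3 fun f => (branch one zero ⬝ c).val (e.cons (σ := Ty.pure 1) f) := by
    rw [val, evalIn, hE, evalIn_lam]; rfl
  have h' := exists3_eq_zero fun f => (branch one zero ⬝ c).val (e.cons (σ := Ty.pure 1) f)
  rw [← h] at h'
  rw [val_app, seq_branch]
  simp only [val_app, seq_branch, val_one, val_zero, ite_eq_right_iff, one_ne_zero, imp_false,
    h', not_exists, not_not]

/-- The semantic counterpart of `Proves.dec`, by the same induction. Here it is enough to know when
the term vanishes, as `branch` only tests for `0`. -/
theorem val_dec_eq_zero {E : Tm Γ (Ty.pure 3)} {D : Tm Γ (Ty.pure 2)} {e : Env Γ}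
    (hE : E.evalIn e = exists3)
    (hD : ∀ f : ℕ → ℕ, (D.evalIn e f : ℕ) = 0 ↔ f 0 < f 1)
    (φ : Fm Γ) (hφ : φ.SecondOrder) : (dec E D φ).val e = 0 ↔ φ.Sat e := by
  induction φ with
  | eq s t =>
    have h : ∀ a b : Tm _ Ty.nat, (D ⬝ branch a b).val e = 0 ↔ a.val e < b.val e := fun a b =>
      (hD ((branch a b).seq e)).trans (by simp)
    simp only [dec, val_app, seq_branch, val_one, val_zero, Fm.sat_eq]
    simp only [h]
    split_ifs <;> simp <;> omega
  | lt s t => exact (hD ((branch s t).seq e)).trans (by simp [Fm.sat_lt])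
  | bot => simp [dec, Fm.Sat]
  | imp φ ψ ih₁ ih₂ =>
    rw [Fm.Sat, ← ih₁ hE hD hφ.1, ← ih₂ hE hD hφ.2]
    simp [dec]
  | all σ φ ih =>
    have h : φ.SecondOrder → ∀ x,
        ((dec E.wk D.wk φ).val (e.cons x) = 0 ↔ φ.Sat (e.cons x)) :=
      fun h x => ih (by simpa using hE) (by simpa using hD) h
    clear ih
    match σ, φ, hφ, h with
    | Ty.nat, φ, hφ, h =>
      rw [dec, val_exists3_lam hE, Fm.Sat]
      simp only [← h hφ]
      have h' : ∀ f : ℕ → ℕ, ((dec E.wk D.wk φ).subst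
          (Sub.cons (v0 ⬝ zero) (Sub.shift _ (Ty.pure 1)))).val (e.cons (σ := Ty.pure 1) f) =
          (dec E.wk D.wk φ).val (e.cons (σ := Ty.nat) (f 0)) := by
        intro f
        rw [val, evalIn_subst, val]
        congr 1
        funext τ v
        cases v <;> rfl
      simp only [h']
      exact ⟨fun h n => h fun _ => n, fun h f => h (f 0)⟩
    | Ty.nat ⇒ Ty.nat, φ, hφ, h =>
      rw [dec, val_exists3_lam hE, Fm.Sat]
      exact forall_congr' fun f => h hφ f

end Tm

/-! ### The `Ψ`-functional -/

namespace Tm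

/-- The `n`-th rational ball is contained in `Y`; the variables are `n`, `i`, `Y` and `E`. -/
def psiFm : Fm [Ty.nat, Ty.nat, Ty.pure 1 ⇒ Ty.pure 1, Ty.pure 3] :=
  Fm.ballSubset (ratReal (ballCentre v0)) (ballRadius v0) (var Var.zero.succ.succ)

/-- The characteristic functional of `f 0 < f 1`. -/
def ltDec : Tm Γ (Ty.pure 2) := lam (ltz (v0 ⬝ zero) (v0 ⬝ one))

/-- The radius of the `n`-th rational ball, replaced by `0` unless the ball is contained in `Y`. -/
def psiRadius : Tm [Ty.nat, Ty.nat, Ty.pure 1 ⇒ Ty.pure 1, Ty.pure 3] Ty.nat :=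
  branch (ballRadius v0) qzero ⬝ dec (var Var.zero.succ.succ.succ) ltDec psiFm

/-- The term that defines a `Ψ`-functional from `∃³`. -/
def psiTerm : Tm [] (Ty.pure 3 ⇒ (Ty.pure 1 ⇒ Ty.pure 1) ⇒ Ty.nat ⇒ Ty.pure 1) :=
  lam (lam (lam (lam (branch (ballCentre v0) psiRadius ⬝ v1))))

theorem evalIn_ltDec (e : Env Γ) (f : ℕ → ℕ) : (ltDec.evalIn e f : ℕ) = 0 ↔ f 0 < f 1 := by
  rw [ltDec, evalIn_lam]
  exact val_ltz_eq_zero _ _ _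

/-- The assignment to the variables of the terms above. -/
noncomputable def psiEnv (Y : (ℕ → ℕ) → ℕ → ℕ) (i n : ℕ) :
    Env [Ty.nat, Ty.nat, Ty.pure 1 ⇒ Ty.pure 1, Ty.pure 3] :=
  Env.cons (σ := Ty.nat) n (Env.cons (σ := Ty.nat) i
    (Env.cons (σ := Ty.pure 1 ⇒ Ty.pure 1) Y (Env.cons (σ := Ty.pure 3) exists3 Env.nil)))

theorem eval_psiTerm (Y : (ℕ → ℕ) → ℕ → ℕ) (i n : ℕ) :
    psiTerm.eval exists3 Y i n =
      if i = 0 then (ballCentre v0).val (psiEnv Y i n) else psiRadius.val (psiEnv Y i n) := by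
  have h : psiTerm.eval = psiTerm.evalIn Env.nil := (evalIn_closed _ _).symm
  rw [h, psiTerm]
  simp only [evalIn_lam]
  exact seq_branch _ _ _ _

theorem val_ballCentre (Y : (ℕ → ℕ) → ℕ → ℕ) (i n : ℕ) :
    (ballCentre v0).val (psiEnv Y i n) = n.unpair.1 := by
  rw [ballCentre, val_fst, psiEnv, val_v0]

theorem ratOf_ballRadius (Y : (ℕ → ℕ) → ℕ → ℕ) (i n : ℕ) :
    ratOf ((ballRadius v0).val (psiEnv Y i n)) =
      ((n.unpair.2.unpair.1 : ℚ) + 1) / (n.unpair.2.unpair.2 + 1) := by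
  rw [ballRadius, ratOf_qmk _ _ _ _ (by simp), psiEnv]
  simp

open Classical in
theorem ratOf_psiRadius {Y : (ℕ → ℕ) → ℕ → ℕ} {F : ℝ → ℝ} (hY : CodesFun Y F) (i n : ℕ) :
    ratOf (psiRadius.val (psiEnv Y i n)) =
      if Metric.ball (((ratOf n.unpair.1) : ℚ) : ℝ)
        ((((n.unpair.2.unpair.1 : ℚ) + 1) / (n.unpair.2.unpair.2 + 1) : ℚ) : ℝ) ⊆ {x | 0 < F x}
      then ((n.unpair.2.unpair.1 : ℚ) + 1) / (n.unpair.2.unpair.2 + 1) else 0 := by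
  have hE : (var Var.zero.succ.succ.succ : Tm _ (Ty.pure 3)).evalIn (psiEnv Y i n) = exists3 := rfl
  have hY' : CodesFun ((var Var.zero.succ.succ : Tm _ (Ty.pure 1 ⇒ Ty.pure 1)).evalIn
    (psiEnv Y i n)) F := hY
  have hc := Fm.codesReal_ratReal (psiEnv Y i n) (ballCentre v0)
  have h := val_dec_eq_zero hE (evalIn_ltDec _) psiFm (Fm.secondOrder_ballSubset _ _ _)
  have h' := Fm.sat_ballSubset (psiEnv Y i n) hc (ballRadius v0) hY'
  rw [val_ballCentre, ratOf_ballRadius] at h'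
  have hval : psiRadius.val (psiEnv Y i n) = if
      (dec (var Var.zero.succ.succ.succ) ltDec psiFm).val (psiEnv Y i n) = 0
      then (ballRadius v0).val (psiEnv Y i n) else qzero.val (psiEnv Y i n) :=
    seq_branch _ _ _ _
  rw [hval, apply_ite ratOf, ratOf_ballRadius, ratOf_qzero]
  exact if_congr (h.trans h') rfl rfl

end Tm

/-- Each point of an open set lies in a rational ball inside the set; the balls that are not inside
are listed with radius `0` and contribute nothing. -/
theorem isPsiFunctional_psiTerm : IsPsiFunctional (Tm.psiTerm.eval exists3) := by
  intro Y F hY hF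
  have hc : ∀ n, Tm.psiTerm.eval exists3 Y (0 : ℕ) n = n.unpair.1 := fun n => by
    rw [Tm.eval_psiTerm, if_pos rfl, Tm.val_ballCentre]
  have hr := fun n : ℕ => (congrArg ratOf (Tm.eval_psiTerm Y 1 n)).trans (Tm.ratOf_psiRadius hY 1 n)
  refine ⟨fun n => ?_, Set.Subset.antisymm (fun x hx => ?_) (Set.iUnion_subset fun n => ?_)⟩
  · rw [hr]
    split_ifs
    · positivity
    · rfl
  · obtain ⟨ε, hε, hball⟩ := Metric.isOpen_iff.1 hF x hx
    -- A ball of radius `1 / (k + 1)` whose centre is closer than that to `x` contains `x` and stays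
    -- inside `B(x, ε)`, because `2 / (k + 1) < ε`.
    obtain ⟨k, hk⟩ := exists_nat_one_div_lt (half_pos hε)
    have hk₀ : (0 : ℝ) < 1 / ((k : ℝ) + 1) := by positivity
    obtain ⟨q, h₁, h₂⟩ := exists_rat_btwn (show x < x + 1 / ((k : ℝ) + 1) by linarith)
    obtain ⟨c, rfl⟩ := exists_ratOf q
    have hdist : dist x (ratOf c : ℚ) < 1 / ((k : ℝ) + 1) := by
      rw [Real.dist_eq, abs_lt]
      constructor <;> linarith
    -- The index of the ball with centre coded by `c` and radius `(0 + 1) / (k + 1)`.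
    refine Set.mem_iUnion.2 ⟨Nat.pair c (Nat.pair 0 k), ?_⟩
    rw [hc, hr]
    simp only [Nat.unpair_pair, Nat.cast_zero, zero_add]
    rw [if_pos]
    · simpa using hdist
    · refine (Metric.ball_subset_ball' ?_).trans hball
      simp only [Nat.unpair_pair, Nat.cast_zero, zero_add]
      rw [dist_comm]
      push_cast
      linarith
  · rw [hc, hr]
    split_ifs with h
    · exact h
    · simp

end

end FinTypes

open FinTypes in
theorem theorem4p17 :
    Proves Z2Omega [] Fm.openPrinciple ∧
    ∃ t : Tm [] (Ty.pure 3 ⇒ (Ty.pure 1 ⇒ Ty.pure 1) ⇒ Ty.nat ⇒ Ty.pure 1),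
      IsPsiFunctional (t.eval exists3) :=
  ⟨Proves.openPrinciple, Tm.psiTerm, isPsiFunctional_psiTerm⟩
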